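/- Let $M$ be a connected smooth $10$-manifold with a smooth Lorentzian metric $g$ of signature $(-,+,\dots,+)$ and a spin structure, and let $\nabla$ be the Levi-Civita (spin) connection. Let $\Gamma_A$ be real $32\times 32$ gamma matrices, $\Gamma_A\Gamma_B+\Gamma_B\Gamma_A=2\eta_{AB}$, and let $S^+$ be the rank $16$ bundle of Majorana-Weyl spinors of positive chirality. Let $\phi$ be a smooth real function (the dilaton) and $H$ a smooth three-form on $M$, and let $F$ be the curvature of a connection on a principal $G$-bundle over $M$, where $G$ is any closed subgroup of some $\mathrm{GL}(N,\mathbb{R})$ (for instance $E_8\times E_8$ or $\mathrm{Spin}(32)/\mathbb{Z}_2$). A Killing spinor on an open set $V\subseteq M$ is a smooth section $\varepsilon$ of $S^+$ over $V$ with - (type I) $\nabla_M\varepsilon+\tfrac18 H_{MNR}\Gamma^{NR}\varepsilon=0$, $\ \Gamma^M\partial_M\phi\,\varepsilon+\tfrac1{12}H_{MNR}\Gamma^{MNR}\varepsilon=0$, $\ F_{MN}\Gamma^{MN}\varepsilon=0$; - (heterotic) $\nabla^+\varepsilon=0$, $\ \Gamma^M\partial_M\phi\,\varepsilon-\tfrac1{12}H_{MNR}\Gamma^{MNR}\varepsilon=0$,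 $\ F_{MN}\Gamma^{MN}\varepsilon=0$, where $\nabla^+=\nabla+\tfrac12H$ is the connection with torsion, that is, $\nabla^+_M=\nabla_M\pm\tfrac18H_{MNR}\Gamma^{NR}$ on spinors (with either fixed sign convention). Call the background maximally supersymmetric if every point of $M$ has a connected open neighbourhood $V$ (possibly $V=M$) on which there are sixteen linearly independent Killing spinors. Theorem. Let $(M,g,\phi,H,F)$ be a maximally supersymmetric background of type I or heterotic supergravity (in particular, any maximally supersymmetric solution of the field equations). Then $(M,g)$ is locally isometric to ten-dimensional Minkowski space, all fluxes vanish, $H=0$ and $F=0$, and the dilaton $\phi$ is constant. -/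

import Mathlib

-- Keeps `chartedSpaceSelf` as the manifold structure that is found on `ℝ` and `ℝ¹⁰`.
attribute [-instance] TopCat.of.chartedSpace TopCat.of.hasGroupoid

open scoped Manifold ContDiff Matrix

noncomputable section

namespace Sugra

/-! ### Minkowski space and gamma matrices -/

/-- The model vector space `ℝ¹⁰`, with coordinates `x⁰, …, x⁹`. -/
abbrev R10 : Type := EuclideanSpace ℝ (Fin 10)

/-- The diagonal entries of the mostly plus Minkowski metric `diag(-1, 1, …, 1)`. -/
def eta (A : Fin 10) : ℝ := if A = 0 then -1 else 1

/-- The Minkowski inner product on `ℝ¹⁰`. -/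
def minkowski (u v : R10) : ℝ := ∑ A, eta A * u A * v A

/-- Real `32 × 32` matrices. -/
abbrev Mat32 : Type := Matrix (Fin 32) (Fin 32) ℝ

/-- Ten-dimensional Majorana gamma matrices `Γ_A`: a real `32`-dimensional (hence irreducible)
representation of the Clifford algebra `Γ_A Γ_B + Γ_B Γ_A = 2 η_{AB} 1`. -/
structure GammaMatrices where
  Γ : Fin 10 → Mat32
  clifford : ∀ A B, Γ A * Γ B + Γ B * Γ A = (if A = B then 2 * eta A else 0) • (1 : Mat32)

namespace GammaMatrices

variable (γ : GammaMatrices)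

/-- Clifford multiplication by a vector `v = v^A e_A`. -/
def slash (v : Fin 10 → ℝ) : Mat32 := ∑ A, v A • γ.Γ A

/-- The antisymmetrised product `Γ_{[A₁} ⋯ Γ_{A_k]}` (with weight `1/k!`). -/
def anti {k : ℕ} (a : Fin k → Fin 10) : Mat32 :=
  ((k.factorial : ℝ)⁻¹) •
    ∑ σ : Equiv.Perm (Fin k),
      (((Equiv.Perm.sign σ : ℤˣ) : ℤ) : ℝ) • (List.ofFn fun j => γ.Γ (a (σ j))).prod

/-- The antisymmetrised product with all indices raised, `Γ^{A₁ ⋯ A_k}`. -/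
def up {k : ℕ} (a : Fin k → Fin 10) : Mat32 := (∏ j, eta (a j)) • γ.anti a

/-- The chirality operator `Γ_0 Γ_1 ⋯ Γ_9`. -/
def chirality : Mat32 := (List.ofFn γ.Γ).prod

/-- The group `Spin(1,9)` inside the Clifford algebra: products of an even number of vectors
`v` with `η(v,v) = ±1`. This set of matrices is closed under inverses, since
`(v w)⁻¹ = ± w v`. -/
def spin : Submonoid Mat32 :=
  Submonoid.closure {T | ∃ v w : Fin 10 → ℝ,
    ((∑ A, eta A * v A ^ 2 = 1) ∨ (∑ A, eta A * v A ^ 2 = -1)) ∧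
    ((∑ A, eta A * w A ^ 2 = 1) ∨ (∑ A, eta A * w A ^ 2 = -1)) ∧
    T = γ.slash v * γ.slash w}

end GammaMatrices

/-! ### Lorentzian geometry -/

section Manifold

variable (M : Type*) [TopologicalSpace M] [ChartedSpace R10 M] [IsManifold (𝓡 10) ∞ M]

/-- (Not necessarily smooth) vector fields on `M`. -/
abbrev VField : Type _ := (x : M) → TangentSpace (𝓡 10) x

variable {M}

/-- The vector field `X` is smooth on the set `O`. -/
def SmoothVFieldOn (X : VField M) (O : Set M) : Prop :=
  ContMDiffOn (𝓡 10) (𝓡 10).tangent ∞ (fun x => (⟨x, X x⟩ : TangentBundle (𝓡 10) M)) O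

/-- The real function `f` is smooth on the set `O`. -/
def SmoothFunOn (f : M → ℝ) (O : Set M) : Prop := ContMDiffOn (𝓡 10) 𝓘(ℝ, ℝ) ∞ f O

/-- The derivative `v(f)` of a real function in the direction of a tangent vector. -/
def dirDeriv (f : M → ℝ) (x : M) (v : TangentSpace (𝓡 10) x) : ℝ :=
  mfderiv (𝓡 10) 𝓘(ℝ, ℝ) f x v

variable (M)

/-- A smooth Lorentzian metric on `M`, of signature `(-, +, …, +)`. -/
structure LorentzMetric where
  g : (x : M) → TangentSpace (𝓡 10) x →ₗ[ℝ] TangentSpace (𝓡 10) x →ₗ[ℝ] ℝ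
  symm : ∀ x u v, g x u v = g x v u
  signature : ∀ x, ∃ b : Module.Basis (Fin 10) ℝ (TangentSpace (𝓡 10) x),
    ∀ A B, g x (b A) (b B) = if A = B then eta A else 0
  smooth : ∀ (O : Set M) (X Y : VField M), IsOpen O → SmoothVFieldOn X O → SmoothVFieldOn Y O →
    SmoothFunOn (fun x => g x (X x) (Y x)) O

/-- A smooth differential three-form on `M`. -/
structure ThreeForm where
  form : (x : M) → TangentSpace (𝓡 10) x [⋀^Fin 3]→ₗ[ℝ] ℝ
  smooth : ∀ (O : Set M) (X : Fin 3 → VField M), IsOpen O → (∀ j, SmoothVFieldOn (X j) O) →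
    SmoothFunOn (fun x => form x fun j => X j x) O

variable {M}

/-- A spin structure on the Lorentzian manifold `(M, g)`, given by an open cover `U i`, smooth
orthonormal frames `e i` over `U i`, and a smooth `Spin(1,9)`-valued cocycle `t i j` that lifts
the changes of frame. -/
structure SpinStructure (γ : GammaMatrices) (g : LorentzMetric M) (ι : Type*) where
  U : ι → Set M
  isOpen : ∀ i, IsOpen (U i)
  cover : ∀ x, ∃ i, x ∈ U i
  e : ι → Fin 10 → VField M
  e_smooth : ∀ i A, SmoothVFieldOn (e i A) (U i)
  orthonormal : ∀ i, ∀ x ∈ U i, ∀ A B, g.g x (e i A x) (e i B x) = if A = B then eta A else 0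
  t : ι → ι → M → Mat32
  t_spin : ∀ i j, ∀ x ∈ U i ∩ U j, t i j x ∈ γ.spin
  t_smooth : ∀ i j a b, SmoothFunOn (fun x => t i j x a b) (U i ∩ U j)
  cocycle : ∀ i j k, ∀ x ∈ U i ∩ U j ∩ U k, t i j x * t j k x = t i k x
  /-- Clifford multiplication by a tangent vector, whose components in the frame `e i` are
  `v^A = η^{AA} g(e_A, v)`, is compatible with the change of trivialisation. -/
  lift : ∀ i j, ∀ x ∈ U i ∩ U j, ∀ v : TangentSpace (𝓡 10) x,
    γ.slash (fun A => eta A * g.g x (e i A x) v) * t i j x =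
      t i j x * γ.slash (fun A => eta A * g.g x (e j A x) v)

/-- The coefficients `ω_{C A B} = g(e_A, ∇_{e_C} e_B)` of the Levi-Civita connection in an
orthonormal frame, by the Koszul formula. -/
def leviCivita (g : LorentzMetric M) (e : Fin 10 → VField M) (x : M) (C A B : Fin 10) : ℝ :=
  (1 / 2) *
    (g.g x (VectorField.mlieBracket (𝓡 10) (e C) (e B) x) (e A x)
      - g.g x (VectorField.mlieBracket (𝓡 10) (e C) (e A) x) (e B x)
      - g.g x (VectorField.mlieBracket (𝓡 10) (e B) (e A) x) (e C x))

/-- The spinor covariant derivative `e_C(ψ) + ¼ om_{C A B} Γ^{AB} ψ` that is induced from a metric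
connection with coefficients `om_{C A B}` in the frame `e`. -/
def spinDeriv (γ : GammaMatrices) (e : Fin 10 → VField M) (om : Fin 10 → Fin 10 → Fin 10 → ℝ)
    (ψ : M → Fin 32 → ℝ) (x : M) (C : Fin 10) : Fin 32 → ℝ :=
  (fun a => dirDeriv (fun y => ψ y a) x (e C x)) +
    ((1 / 4 : ℝ) • ∑ A, ∑ B, om C A B • γ.up ![A, B]) *ᵥ ψ x

/-- `(M, g)` is locally isometric to Minkowski space. -/
def LocallyMinkowski (g : LorentzMetric M) : Prop :=
  ∀ x : M, ∃ Φ : PartialDiffeomorph (𝓡 10) (𝓡 10) M R10 ∞, x ∈ Φ.source ∧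
    ∀ y ∈ Φ.source, ∀ u v : TangentSpace (𝓡 10) y,
      minkowski (mfderiv (𝓡 10) (𝓡 10) Φ y u) (mfderiv (𝓡 10) (𝓡 10) Φ y v) = g.g y u v

/-! ### Gauge fields -/

/-- The Lie algebra of a closed linear group `G ⊆ GL(N, ℝ)`. -/
def lieAlg {N : ℕ} (G : Subgroup (GL (Fin N) ℝ)) : Set (Matrix (Fin N) (Fin N) ℝ) :=
  {X | ∀ s : ℝ, ∃ h ∈ G, (h : Matrix (Fin N) (Fin N) ℝ) = NormedSpace.exp (s • X)}

variable (M)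

/-- A smooth principal `G`-bundle on `M` with a smooth connection, for a linear group `G`: an
open cover `W k`, a smooth `G`-valued cocycle `h k l`, and gauge potentials `A k`, one-forms on
`W k` with values in the Lie algebra of `G`, such that `A_k = h A_l h⁻¹ - dh h⁻¹`. -/
structure GaugeField {N : ℕ} (G : Subgroup (GL (Fin N) ℝ)) (κ : Type*) where
  W : κ → Set M
  isOpen : ∀ k, IsOpen (W k)
  cover : ∀ x, ∃ k, x ∈ W k
  h : κ → κ → M → GL (Fin N) ℝ
  h_mem : ∀ k l, ∀ x ∈ W k ∩ W l, h k l x ∈ G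
  h_smooth : ∀ k l p q,
    SmoothFunOn (fun x => (h k l x : Matrix (Fin N) (Fin N) ℝ) p q) (W k ∩ W l)
  cocycle : ∀ k l m, ∀ x ∈ W k ∩ W l ∩ W m, h k l x * h l m x = h k m x
  A : κ → (x : M) → TangentSpace (𝓡 10) x →ₗ[ℝ] Matrix (Fin N) (Fin N) ℝ
  A_mem : ∀ k, ∀ x ∈ W k, ∀ v, A k x v ∈ lieAlg G
  A_smooth : ∀ k (O : Set M) (X : VField M), IsOpen O → O ⊆ W k → SmoothVFieldOn X O →
    ∀ p q, SmoothFunOn (fun x => A k x (X x) p q) O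
  A_trans : ∀ k l, ∀ x ∈ W k ∩ W l, ∀ v,
    A k x v * (h k l x : Matrix (Fin N) (Fin N) ℝ) =
      (h k l x : Matrix (Fin N) (Fin N) ℝ) * A l x v -
        Matrix.of fun p q => dirDeriv (fun y => (h k l y : Matrix (Fin N) (Fin N) ℝ) p q) x v

variable {M}

/-- The curvature `F = dA + A ∧ A` in the trivialisation `k`, evaluated on vector fields:
`F(X,Y) = X(A(Y)) - Y(A(X)) - A([X,Y]) + A(X) A(Y) - A(Y) A(X)`. -/
def GaugeField.curv {N : ℕ} {G : Subgroup (GL (Fin N) ℝ)} {κ : Type*} (a : GaugeField M G κ)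
    (k : κ) (X Y : VField M) (x : M) : Matrix (Fin N) (Fin N) ℝ :=
  (Matrix.of fun p q => dirDeriv (fun y => a.A k y (Y y) p q) x (X x)) -
    (Matrix.of fun p q => dirDeriv (fun y => a.A k y (X y) p q) x (Y x)) -
    a.A k x (VectorField.mlieBracket (𝓡 10) X Y x) +
    a.A k x (X x) * a.A k x (Y x) - a.A k x (Y x) * a.A k x (X x)

/-! ### Backgrounds and Killing spinors -/

variable (M)

/-- A bosonic background of type I or heterotic supergravity: a Lorentzian metric with a spin
structure, a dilaton, a three-form field strength, and a gauge field. -/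
structure Background (γ : GammaMatrices) {N : ℕ} (G : Subgroup (GL (Fin N) ℝ))
    (ι κ : Type*) where
  metric : LorentzMetric M
  spin : SpinStructure γ metric ι
  φ : M → ℝ
  φ_smooth : SmoothFunOn φ Set.univ
  H : ThreeForm M
  gauge : GaugeField M G κ

/-- The two kinds of theory. For the heterotic theories, the sign `s` fixes the convention by
which the torsion `½ H` of the connection `∇⁺ = ∇ + ½ H` enters the spin connection. -/
inductive Theory where
  | typeI : Theory
  | heterotic (s : ℤˣ) : Theory

variable {M}

namespace Background

variable {γ : GammaMatrices} {N : ℕ} {G : Subgroup (GL (Fin N) ℝ)} {ι κ : Type*}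
  (B : Background M γ G ι κ)

/-- The components `H_{ABC}` in the frame `e i`. -/
def Hcomp (i : ι) (x : M) (A₁ A₂ A₃ : Fin 10) : ℝ :=
  B.H.form x ![B.spin.e i A₁ x, B.spin.e i A₂ x, B.spin.e i A₃ x]

/-- The gravitino Killing spinor operator in the direction `e_C`: `∇_C + ⅛ H_{CAB} Γ^{AB}` for
type I, and the spinor lift of `∇⁺ = ∇ + ½ H` in the heterotic case. -/
def gravitino (T : Theory) (i : ι) (ψ : M → Fin 32 → ℝ) (x : M) (C : Fin 10) : Fin 32 → ℝ :=
  match T with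
  | .typeI =>
      spinDeriv γ (B.spin.e i) (leviCivita B.metric (B.spin.e i) x) ψ x C +
        ((1 / 8 : ℝ) • ∑ A₁, ∑ A₂, B.Hcomp i x C A₁ A₂ • γ.up ![A₁, A₂]) *ᵥ ψ x
  | .heterotic s =>
      spinDeriv γ (B.spin.e i)
        (fun C A₁ A₂ => leviCivita B.metric (B.spin.e i) x C A₁ A₂ +
          ((s : ℤ) : ℝ) * (1 / 2) * B.Hcomp i x C A₁ A₂) ψ x C

/-- The dilatino operator `Γ^M ∂_M φ ± (1/12) H_{MNR} Γ^{MNR}`, with the upper sign for type I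
and the lower sign for the heterotic theories. -/
def dilatino (T : Theory) (i : ι) (x : M) : Mat32 :=
  (∑ A, dirDeriv B.φ x (B.spin.e i A x) • γ.up ![A]) +
    (match T with
      | .typeI => (1 / 12 : ℝ)
      | .heterotic _ => -(1 / 12 : ℝ)) •
      ∑ A₁, ∑ A₂, ∑ A₃, B.Hcomp i x A₁ A₂ A₃ • γ.up ![A₁, A₂, A₃]

/-- The gaugino operator `F_{MN} Γ^{MN}`, for the component `(p, q)` of `F`. -/
def gaugino (i : ι) (k : κ) (p q : Fin N) (x : M) : Mat32 :=
  ∑ A₁, ∑ A₂, B.gauge.curv k (B.spin.e i A₁) (B.spin.e i A₂) x p q • γ.up ![A₁, A₂]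

/-- `ψ` is a Killing spinor over the open set `V`: a smooth section over `V` of the bundle of
positive chirality Majorana-Weyl spinors, given by its local representatives `ψ i` over
`V ∩ U i`, that solves the gravitino, dilatino and gaugino equations. -/
structure IsKillingSpinor (T : Theory) (V : Set M) (ψ : ι → M → Fin 32 → ℝ) : Prop where
  smooth : ∀ i a, SmoothFunOn (fun x => ψ i x a) (V ∩ B.spin.U i)
  glue : ∀ i j, ∀ x ∈ V ∩ (B.spin.U i ∩ B.spin.U j), ψ i x = B.spin.t i j x *ᵥ ψ j x
  chiral : ∀ i, ∀ x ∈ V ∩ B.spin.U i, γ.chirality *ᵥ ψ i x = ψ i x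
  gravitino : ∀ i, ∀ x ∈ V ∩ B.spin.U i, ∀ C, B.gravitino T i (ψ i) x C = 0
  dilatino : ∀ i, ∀ x ∈ V ∩ B.spin.U i, B.dilatino T i x *ᵥ ψ i x = 0
  gaugino : ∀ i k, ∀ x ∈ V ∩ B.spin.U i ∩ B.gauge.W k, ∀ p q,
    B.gaugino i k p q x *ᵥ ψ i x = 0

/-- Over the set `V` there are sixteen Killing spinors, linearly independent over `ℝ`. -/
def MaximalOn (T : Theory) (V : Set M) : Prop :=
  ∃ ψ : Fin 16 → ι → M → Fin 32 → ℝ, (∀ n, B.IsKillingSpinor T V (ψ n)) ∧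
    ∀ c : Fin 16 → ℝ,
      (∀ i, ∀ x ∈ V ∩ B.spin.U i, ∑ n, c n • ψ n i x = 0) → ∀ n, c n = 0

/-- The background is (locally) maximally supersymmetric: every point has a connected open
neighbourhood that carries sixteen linearly independent Killing spinors. The neighbourhood may
be all of `M`, so that this includes backgrounds with sixteen global Killing spinors. -/
def MaximallySupersymmetric (T : Theory) : Prop :=
  ∀ x : M, ∃ V : Set M, IsOpen V ∧ IsConnected V ∧ x ∈ V ∧ B.MaximalOn T V

end Background

end Manifold

end Sugra

end

noncomputable section

namespace Sugra

/-! The gravitino equation is a first-order linear differential equation, so a combination of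
Killing spinors that vanishes at one point of a connected open set vanishes on all of it. Sixteen
independent Killing spinors are therefore independent at every point, and since positive chirality
spinors form a space of dimension at most 16, their values span it (`Background.span_eq_plus`).

The dilatino and gaugino equations are algebraic, so their matrices annihilate every positive
chirality spinor. Products of one, two or three distinct gamma matrices are trace-orthogonal, and
the chirality operator, a product of all ten, is too long to spoil this when the degrees are small.
Each coefficient can thus be read off from a trace: `eq_zero_of_one_form_add_three_form_eq_zero`
gives dφ = 0 and H = 0, and `eq_zero_of_two_form_eq_zero` gives F = 0.

With H = 0 the Killing spinors are parallel for the Levi-Civita connection. An invariant form K on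
spinors (`exists_spinor_form`) turns pairs of them into parallel covectors ε₁ᵀ K Γ_D ε₂
(`bilinear_spinRep`), and at a point these span the whole cotangent space (`exists_coeff_of_span`).
Constant combinations give a parallel coframe, orthonormal everywhere because it is so at one point.
Absence of torsion makes it closed, hence exact on a ball, and the primitives are Minkowski
coordinates (`exists_flat_coordinates`). The curvature tensor is never needed. -/

lemma eta_mul_self (A : Fin 10) : eta A * eta A = 1 := by
  unfold eta; split <;> norm_num

lemma eta_ne_zero (A : Fin 10) : eta A ≠ 0 := by
  unfold eta; split <;> norm_num

namespace GammaMatrices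

variable (γ : GammaMatrices)

/-! ### Words in the gamma matrices and their traces -/

lemma sq (A : Fin 10) : γ.Γ A * γ.Γ A = eta A • (1 : Mat32) := by
  have h := γ.clifford A A
  rw [if_pos rfl, ← two_smul ℝ (γ.Γ A * γ.Γ A), mul_smul] at h
  exact smul_right_injective _ (two_ne_zero : (2 : ℝ) ≠ 0) h

lemma anticomm {A B : Fin 10} (h : A ≠ B) : γ.Γ A * γ.Γ B = -(γ.Γ B * γ.Γ A) := by
  have h := γ.clifford A B
  rw [if_neg ‹_›, zero_smul] at h
  exact eq_neg_of_add_eq_zero_left h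

/-- The product of gamma matrices along a list of indices. -/
def word (w : List (Fin 10)) : Mat32 := (w.map γ.Γ).prod

@[simp] lemma word_nil : γ.word [] = 1 := rfl

@[simp] lemma word_cons (a : Fin 10) (w : List (Fin 10)) : γ.word (a :: w) = γ.Γ a * γ.word w := by
  simp [word]

lemma word_append (v w : List (Fin 10)) : γ.word (v ++ w) = γ.word v * γ.word w := by
  simp [word]

/-- Γ_C changes sign past every letter other than C. The number of these is length − count, which
has the parity of length + count; the sum avoids natural subtraction. -/
lemma Γ_mul_word (C : Fin 10) (w : List (Fin 10)) :
    γ.Γ C * γ.word w = (-1 : ℝ) ^ (w.length + w.count C) • (γ.word w * γ.Γ C) := by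
  induction w with
  | nil => simp
  | cons a w ih =>
    by_cases h : C = a
    · subst h
      rw [List.length_cons, List.count_cons_self,
        show w.length + 1 + (w.count C + 1) = w.length + w.count C + 2 by ring, pow_add, word_cons,
        ih, Matrix.smul_mul, Matrix.mul_smul, ← Matrix.mul_assoc, ih]
      simp [Matrix.mul_assoc]
    · rw [word_cons, ← Matrix.mul_assoc, γ.anticomm h, neg_mul, Matrix.mul_assoc, ih,
        List.length_cons, List.count_cons_of_ne (Ne.symm h),
        show w.length + 1 + w.count C = w.length + w.count C + 1 by ring, pow_succ]
      simp [Matrix.mul_assoc]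

/-- The parity condition says that Γ_C anticommutes with the word. As Γ_C² is a nonzero scalar,
cyclicity of the trace gives tr = −tr. -/
lemma trace_word {w : List (Fin 10)} (C : Fin 10) (h : Odd (w.length + w.count C)) :
    (γ.word w).trace = 0 := by
  have h1 : γ.Γ C * γ.word w = -(γ.word w * γ.Γ C) := by
    rw [Γ_mul_word, h.neg_one_pow]; simp
  have h2 : (γ.Γ C * (γ.Γ C * γ.word w)).trace = eta C * (γ.word w).trace := by
    rw [← Matrix.mul_assoc, γ.sq]; simp [Matrix.trace_smul]
  have h3 : (γ.Γ C * (γ.Γ C * γ.word w)).trace = -(eta C * (γ.word w).trace) := by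
    rw [h1, mul_neg, Matrix.trace_neg, ← Matrix.mul_assoc, Matrix.trace_mul_comm, h2]
  have h4 : eta C * (γ.word w).trace = 0 := by linarith
  exact (mul_eq_zero.1 h4).resolve_left (eta_ne_zero C)

/-! ### The chirality operator and positive chirality spinors -/

lemma chirality_eq_word : γ.chirality = γ.word (List.finRange 10) := by
  rw [chirality, word, List.ofFn_eq_map]

lemma word_sq_cons {a : Fin 10} {w : List (Fin 10)} (h : a ∉ w) :
    γ.word (a :: w) * γ.word (a :: w) =
      ((-1) ^ w.length * eta a) • (γ.word w * γ.word w) := by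
  have h1 : γ.word w * γ.Γ a = (-1 : ℝ) ^ w.length • (γ.Γ a * γ.word w) := by
    rw [Γ_mul_word, List.count_eq_zero_of_not_mem h, add_zero, smul_smul, ← mul_pow]
    simp
  calc γ.word (a :: w) * γ.word (a :: w) = γ.Γ a * (γ.word w * γ.Γ a) * γ.word w := by
        simp only [word_cons, Matrix.mul_assoc]
    _ = (-1 : ℝ) ^ w.length • (γ.Γ a * γ.Γ a * (γ.word w * γ.word w)) := by
        rw [h1]; simp only [Matrix.mul_assoc, Matrix.mul_smul, Matrix.smul_mul]
    _ = _ := by rw [γ.sq, Matrix.smul_mul, one_mul, smul_smul]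

/-- Reordering contributes (−1)^(9+8+⋯+0) = −1, and the single timelike direction contributes
another −1. -/
lemma chirality_sq : γ.chirality * γ.chirality = 1 := by
  rw [chirality_eq_word, show List.finRange 10 = [0, 1, 2, 3, 4, 5, 6, 7, 8, 9] from by decide]
  repeat rw [word_sq_cons _ (by decide)]
  rw [word_nil, mul_one]
  simp only [smul_smul]
  convert one_smul ℝ (1 : Mat32) using 2
  have h : ∀ A : Fin 10, A ≠ 0 → eta A = 1 := fun A hA => if_neg hA
  rw [h 1 (by decide), h 2 (by decide), h 3 (by decide), h 4 (by decide), h 5 (by decide),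
    h 6 (by decide), h 7 (by decide), h 8 (by decide), h 9 (by decide)]
  norm_num [eta]

lemma chirality_anticomm (C : Fin 10) : γ.Γ C * γ.chirality = -(γ.chirality * γ.Γ C) := by
  rw [chirality_eq_word, Γ_mul_word,
    Odd.neg_one_pow (by rw [List.count_eq_one_of_mem (List.nodup_finRange 10) (by simp)]; simp; decide)]
  simp

/-- A word with fewer than ten letters misses some index C. After appending the chirality word, C
occurs exactly once in a word of even length, so `trace_word` applies. -/
lemma trace_word_mul_chirality {w : List (Fin 10)} (h : Even w.length) (h' : w.length < 10) :
    (γ.word w * γ.chirality).trace = 0 := by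
  obtain ⟨C, hC⟩ : ∃ C, C ∉ w := by
    by_contra! H
    have : (Finset.univ : Finset (Fin 10)).card ≤ w.length :=
      (Finset.card_le_card fun x _ => List.mem_toFinset.2 (H x)).trans w.toFinset_card_le
    simp at this; omega
  rw [chirality_eq_word, ← word_append]
  apply γ.trace_word C
  rw [List.count_append, List.count_eq_zero_of_not_mem hC,
    List.count_eq_one_of_mem (List.nodup_finRange 10) (by simp)]
  simp only [List.length_append, List.length_finRange]
  obtain ⟨k, hk⟩ := h
  exact ⟨k + 5, by omega⟩

/-- Positive chirality spinors. -/
def plus : Submodule ℝ (Fin 32 → ℝ) where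
  carrier := {ψ | γ.chirality *ᵥ ψ = ψ}
  add_mem' := fun {a b} ha hb => by
    simp only [Set.mem_ofPred_eq] at *; rw [Matrix.mulVec_add, ha, hb]
  zero_mem' := by simp
  smul_mem' := fun c a ha => by
    simp only [Set.mem_ofPred_eq] at *; rw [Matrix.mulVec_smul, ha]

lemma mem_plus {ψ : Fin 32 → ℝ} : ψ ∈ γ.plus ↔ γ.chirality *ᵥ ψ = ψ := Iff.rfl

/-- The columns of 1 + `chirality` have positive chirality, so X(1 + `chirality`) = 0 and tr(WX) =
−tr(WX · `chirality`). For W X of low degree the right side vanishes, so knowing X on half of the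
spinors is enough to extract coefficients. -/
lemma trace_mul_eq_zero {X W : Mat32} (hX : ∀ ψ ∈ γ.plus, X *ᵥ ψ = 0)
    (h : (W * X * γ.chirality).trace = 0) : (W * X).trace = 0 := by
  have h1 : X * (1 + γ.chirality) = 0 := by
    ext1 i j
    have : (1 + γ.chirality) *ᵥ Pi.single j 1 ∈ γ.plus := by
      rw [mem_plus, Matrix.mulVec_mulVec, mul_add, chirality_sq, mul_one, add_comm]
    have := congrFun (hX _ this) i
    rw [Matrix.mulVec_mulVec, Matrix.mulVec_single_one] at this
    exact this
  have h2 : (W * (X * (1 + γ.chirality))).trace = 0 := by rw [h1]; simp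
  rwa [mul_add, mul_one, mul_add, Matrix.trace_add, ← Matrix.mul_assoc, h, add_zero] at h2

/-- Γ_0 is injective and reverses chirality, so `plus` and its image under Γ_0 are disjoint
subspaces of equal dimension in ℝ³². -/
lemma finrank_plus_le : Module.finrank ℝ γ.plus ≤ 16 := by
  have hinj : Function.Injective (Matrix.mulVecLin (γ.Γ 0)) := by
    intro a b hab
    have := congrArg (γ.Γ 0 *ᵥ ·) hab
    simpa [Matrix.mulVec_mulVec, γ.sq, Matrix.smul_mulVec, eta_ne_zero] using this
  have hd : Disjoint γ.plus (γ.plus.map (Matrix.mulVecLin (γ.Γ 0))) := by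
    rw [Submodule.disjoint_def]
    rintro x hx ⟨y, hy, rfl⟩
    have hy : γ.chirality *ᵥ y = y := hy
    rw [mem_plus, Matrix.mulVecLin_apply, Matrix.mulVec_mulVec,
      ← neg_neg (γ.chirality * _), ← chirality_anticomm, Matrix.neg_mulVec, ← Matrix.mulVec_mulVec,
      hy] at hx
    exact self_eq_neg.1 hx.symm
  have h1 := Submodule.finrank_add_finrank_le_of_disjoint hd
  rw [(Submodule.equivMapOfInjective _ hinj γ.plus).finrank_eq.symm] at h1
  simp at h1
  omega

end GammaMatrices

/-! ### Sums supported on the permutations of a fixed tuple -/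

/-- Both p and q must occur among the two arguments for a term to survive, which leaves (p, q) and
(q, p). It is applied to f = coefficient times trace. -/
lemma sum_sum_eq_two_mul {f : Fin 10 → Fin 10 → ℝ} {p q : Fin 10} (hpq : p ≠ q)
    (hsymm : f q p = f p q) (hp : ∀ a b, p ≠ a → p ≠ b → f a b = 0)
    (hq : ∀ a b, q ≠ a → q ≠ b → f a b = 0) : ∑ a, ∑ b, f a b = 2 * f p q := by
  have key : ∀ g : Fin 10 → ℝ, (∀ b, p ≠ b → q ≠ b → g b = 0) → ∑ b, g b = g p + g q := by
    intro g hg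
    rw [← Finset.sum_subset (Finset.subset_univ {p, q}), Finset.sum_pair hpq]
    intro x _ hx
    simp only [Finset.mem_insert, Finset.mem_singleton, not_or] at hx
    exact hg x (Ne.symm hx.1) (Ne.symm hx.2)
  have h1 : ∀ a, p ≠ a → q ≠ a → ∀ b, f a b = 0 := by
    intro a ha ha' b
    by_cases hb : p = b
    · exact hq a b ha' (hb ▸ hpq.symm)
    · exact hp a b ha hb
  rw [key _ fun a ha ha' => Finset.sum_eq_zero fun b _ => h1 a ha ha' b,
    key _ fun b hb hb' => hq p b hpq.symm hb', key _ fun b hb hb' => hp q b hpq hb,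
    hq p p hpq.symm hpq.symm, hp q q hpq hpq, hsymm]
  ring

lemma sum_sum_sum_eq_six_mul {f : Fin 10 → Fin 10 → Fin 10 → ℝ} {p q r : Fin 10} (hpq : p ≠ q)
    (hpr : p ≠ r) (hqr : q ≠ r) (h₁ : ∀ a b c, f b a c = f a b c) (h₂ : ∀ a b c, f a c b = f a b c)
    (hp : ∀ a b c, p ≠ a → p ≠ b → p ≠ c → f a b c = 0)
    (hq : ∀ a b c, q ≠ a → q ≠ b → q ≠ c → f a b c = 0)
    (hr : ∀ a b c, r ≠ a → r ≠ b → r ≠ c → f a b c = 0) :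
    ∑ a, ∑ b, ∑ c, f a b c = 6 * f p q r := by
  have key : ∀ g : Fin 10 → ℝ, (∀ b, p ≠ b → q ≠ b → r ≠ b → g b = 0) →
      ∑ b, g b = g p + g q + g r := by
    intro g hg
    rw [← Finset.sum_subset (Finset.subset_univ {p, q, r}), Finset.sum_insert (by simp [hpq, hpr]),
      Finset.sum_pair hqr, add_assoc]
    intro x _ hx
    simp only [Finset.mem_insert, Finset.mem_singleton, not_or] at hx
    exact hg x (Ne.symm hx.1) (Ne.symm hx.2.1) (Ne.symm hx.2.2)
  -- Pigeonhole: if c is none of p, q, r, the two slots a and b cannot hold all three.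
  have h3 : ∀ a b c, p ≠ c → q ≠ c → r ≠ c → f a b c = 0 := by
    intro a b c ha ha' ha''
    by_cases h : p ≠ a ∧ p ≠ b
    · exact hp a b c h.1 h.2 ha
    by_cases h' : q ≠ a ∧ q ≠ b
    · exact hq a b c h'.1 h'.2 ha'
    refine hr a b c ?_ ?_ ha'' <;> grind
  have h2 : ∀ a b c, p ≠ b → q ≠ b → r ≠ b → f a b c = 0 := by
    intro a b c; rw [← h₂]; exact h3 a c b
  have h1 : ∀ a b c, p ≠ a → q ≠ a → r ≠ a → f a b c = 0 := by
    intro a b c; rw [← h₁]; exact h2 b a c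
  have e : ∀ a, ∑ b, ∑ c, f a b c = f a p p + f a p q + f a p r + (f a q p + f a q q + f a q r) +
      (f a r p + f a r q + f a r r) := by
    intro a
    rw [key _ fun b hb hb' hb'' => Finset.sum_eq_zero fun c _ => h2 a b c hb hb' hb'']
    rw [key _ fun c => h3 a p c, key _ fun c => h3 a q c, key _ fun c => h3 a r c]
  rw [key _ fun a ha ha' ha'' => Finset.sum_eq_zero fun b _ => Finset.sum_eq_zero fun c _ =>
    h1 a b c ha ha' ha'']
  rw [e, e, e]
  have zp : ∀ a b c, (p ≠ a ∧ p ≠ b ∧ p ≠ c) → f a b c = 0 := fun a b c h => hp a b c h.1 h.2.1 h.2.2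
  have zq : ∀ a b c, (q ≠ a ∧ q ≠ b ∧ q ≠ c) → f a b c = 0 := fun a b c h => hq a b c h.1 h.2.1 h.2.2
  have zr : ∀ a b c, (r ≠ a ∧ r ≠ b ∧ r ≠ c) → f a b c = 0 := fun a b c h => hr a b c h.1 h.2.1 h.2.2
  have s1 : f p r q = f p q r := h₂ p q r
  have s2 : f q p r = f p q r := h₁ p q r
  have s3 : f q r p = f p q r := by rw [h₂, h₁]
  have s4 : f r p q = f p q r := by rw [h₁, h₂]
  have s5 : f r q p = f p q r := by rw [h₂, h₁, h₂]
  simp [zp, zq, zr, hpq, hpr, hqr, hpq.symm, hpr.symm, hqr.symm, s1, s2, s3, s4, s5]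
  ring

/-! ### Antisymmetrised products of two and three gamma matrices, and their traces -/

namespace GammaMatrices

variable (γ : GammaMatrices)

lemma up_one (A : Fin 10) : γ.up ![A] = eta A • γ.Γ A := by
  simp [up, anti]

lemma univ_perm_three : (Finset.univ : Finset (Equiv.Perm (Fin 3))) =
    {1, Equiv.swap 0 1, Equiv.swap 0 2, Equiv.swap 1 2, Equiv.swap 0 1 * Equiv.swap 1 2,
      Equiv.swap 1 2 * Equiv.swap 0 1} := by decide

lemma up_two (A B : Fin 10) :
    γ.up ![A, B] = (eta A * eta B / 2) • (γ.Γ A * γ.Γ B - γ.Γ B * γ.Γ A) := by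
  have : (Finset.univ : Finset (Equiv.Perm (Fin 2))) = {1, Equiv.swap 0 1} := by decide
  simp only [up, anti, this]
  rw [Finset.sum_pair (by decide)]
  simp [List.ofFn_succ, smul_smul, Fin.prod_univ_succ, sub_eq_add_neg, div_eq_mul_inv]

lemma up_three (A B C : Fin 10) : γ.up ![A, B, C] = (eta A * eta B * eta C / 6) •
    (γ.Γ A * γ.Γ B * γ.Γ C - γ.Γ B * γ.Γ A * γ.Γ C - γ.Γ C * γ.Γ B * γ.Γ A -
      γ.Γ A * γ.Γ C * γ.Γ B + γ.Γ B * γ.Γ C * γ.Γ A + γ.Γ C * γ.Γ A * γ.Γ B) := by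
  simp only [up, anti, univ_perm_three]
  repeat rw [Finset.sum_insert (by decide)]
  rw [Finset.sum_singleton]
  simp [List.ofFn_succ, smul_smul, Fin.prod_univ_succ, Equiv.swap_apply_def, Nat.factorial]
  rw [show eta A * (eta B * eta C) * 6⁻¹ = eta A * eta B * eta C / 6 by ring]
  simp only [smul_sub, Matrix.mul_assoc]
  abel

lemma word_mul_up_two (w : List (Fin 10)) (A B : Fin 10) :
    γ.word w * γ.up ![A, B] =
      (eta A * eta B / 2) • (γ.word (w ++ [A, B]) - γ.word (w ++ [B, A])) := by
  simp only [up_two, word_append, word_cons, word_nil, mul_one, Matrix.mul_smul, Matrix.mul_sub]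

lemma word_mul_up_three (w : List (Fin 10)) (A B C : Fin 10) :
    γ.word w * γ.up ![A, B, C] = (eta A * eta B * eta C / 6) •
      (γ.word (w ++ [A, B, C]) - γ.word (w ++ [B, A, C]) - γ.word (w ++ [C, B, A]) -
        γ.word (w ++ [A, C, B]) + γ.word (w ++ [B, C, A]) + γ.word (w ++ [C, A, B])) := by
  simp only [up_three, word_append, word_cons, word_nil, mul_one, Matrix.mul_smul, Matrix.mul_sub,
    Matrix.mul_add, Matrix.mul_assoc]

lemma trace_word_mul_up_two_mul_chirality {w : List (Fin 10)} (h : Even w.length)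
    (h' : w.length < 8) (A B : Fin 10) :
    (γ.word w * γ.up ![A, B] * γ.chirality).trace = 0 := by
  have e : ∀ a b, (γ.word (w ++ [a, b]) * γ.chirality).trace = 0 := fun a b =>
    γ.trace_word_mul_chirality (by simpa [Nat.even_add] using h) (by simp; omega)
  simp only [word_mul_up_two, Matrix.smul_mul, Matrix.sub_mul, Matrix.trace_smul, Matrix.trace_sub,
    e, sub_zero, smul_zero]

lemma trace_word_mul_up_three_mul_chirality {w : List (Fin 10)} (h : Odd w.length)
    (h' : w.length < 7) (A B C : Fin 10) :
    (γ.word w * γ.up ![A, B, C] * γ.chirality).trace = 0 := by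
  have e : ∀ a b c, (γ.word (w ++ [a, b, c]) * γ.chirality).trace = 0 := fun a b c =>
    γ.trace_word_mul_chirality (by
      obtain ⟨k, hk⟩ := h; exact ⟨k + 2, by simp; omega⟩) (by simp; omega)
  simp only [word_mul_up_three, Matrix.smul_mul, Matrix.sub_mul, Matrix.add_mul, Matrix.trace_smul,
    Matrix.trace_sub, Matrix.trace_add, e, sub_zero, add_zero, smul_zero]

/-- Applied to w = [p, q] in either order and D one of its letters, this says that D must recur
among A, B for the trace to survive: the vanishing hypothesis of `sum_sum_eq_two_mul`. -/
lemma trace_word_mul_up_two {w : List (Fin 10)} {D : Fin 10} (h : Odd (w.length + w.count D))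
    {A B : Fin 10} (hA : D ≠ A) (hB : D ≠ B) : (γ.word w * γ.up ![A, B]).trace = 0 := by
  have e : ∀ a b, D ≠ a → D ≠ b → (γ.word (w ++ [a, b])).trace = 0 := fun a b ha hb =>
    γ.trace_word D (by
      obtain ⟨k, hk⟩ := h
      simp only [List.length_append, List.count_append, List.count_cons, List.count_nil,
        beq_iff_eq, ha.symm, hb.symm, if_false, List.length_cons, List.length_nil]
      exact ⟨k + 1, by omega⟩)
  simp only [word_mul_up_two, Matrix.trace_smul, Matrix.trace_sub, e _ _ hA hB, e _ _ hB hA,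
    sub_zero, smul_zero]

lemma trace_word_mul_up_three {w : List (Fin 10)} {D : Fin 10} (h : Even (w.length + w.count D))
    {A B C : Fin 10} (hA : D ≠ A) (hB : D ≠ B) (hC : D ≠ C) :
    (γ.word w * γ.up ![A, B, C]).trace = 0 := by
  have e : ∀ a b c, D ≠ a → D ≠ b → D ≠ c → (γ.word (w ++ [a, b, c])).trace = 0 :=
    fun a b c ha hb hc => γ.trace_word D (by
      obtain ⟨k, hk⟩ := h
      simp only [List.length_append, List.count_append, List.count_cons, List.count_nil,
        beq_iff_eq, ha.symm, hb.symm, hc.symm, if_false, List.length_cons, List.length_nil]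
      exact ⟨k + 1, by omega⟩)
  simp only [word_mul_up_three, Matrix.trace_smul, Matrix.trace_sub, Matrix.trace_add,
    e _ _ _ hA hB hC, e _ _ _ hB hA hC, e _ _ _ hC hB hA, e _ _ _ hA hC hB, e _ _ _ hB hC hA,
    e _ _ _ hC hA hB, sub_zero, add_zero, smul_zero]

lemma up_two_swap (A B : Fin 10) : γ.up ![B, A] = -γ.up ![A, B] := by
  rw [up_two, up_two, mul_comm (eta B), ← smul_neg, neg_sub]

lemma up_three_swap_left (A B C : Fin 10) : γ.up ![B, A, C] = -γ.up ![A, B, C] := by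
  rw [up_three, up_three, mul_comm (eta B), ← smul_neg]
  congr 1
  abel

lemma up_three_swap_right (A B C : Fin 10) : γ.up ![A, C, B] = -γ.up ![A, B, C] := by
  rw [up_three, up_three, mul_right_comm, ← smul_neg]
  congr 1
  abel

lemma up_two_of_ne {A B : Fin 10} (h : A ≠ B) :
    γ.up ![A, B] = (eta A * eta B) • (γ.Γ A * γ.Γ B) := by
  rw [up_two, γ.anticomm h.symm, sub_neg_eq_add, ← two_smul ℝ, smul_smul, div_mul_cancel₀ _ two_ne_zero]

lemma up_three_of_ne {A B C : Fin 10} (hAB : A ≠ B) (hAC : A ≠ C) (hBC : B ≠ C) :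
    γ.up ![A, B, C] = (eta A * eta B * eta C) • (γ.Γ A * γ.Γ B * γ.Γ C) := by
  have h1 : γ.Γ B * γ.Γ A * γ.Γ C = -(γ.Γ A * γ.Γ B * γ.Γ C) := by
    rw [γ.anticomm hAB.symm, neg_mul]
  have h4 : γ.Γ A * γ.Γ C * γ.Γ B = -(γ.Γ A * γ.Γ B * γ.Γ C) := by
    rw [Matrix.mul_assoc, γ.anticomm hBC.symm, mul_neg, Matrix.mul_assoc]
  have h5 : γ.Γ B * γ.Γ C * γ.Γ A = γ.Γ A * γ.Γ B * γ.Γ C := by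
    rw [Matrix.mul_assoc, γ.anticomm hAC.symm, mul_neg, ← Matrix.mul_assoc, h1, neg_neg]
  have h6 : γ.Γ C * γ.Γ A * γ.Γ B = γ.Γ A * γ.Γ B * γ.Γ C := by
    rw [γ.anticomm hAC.symm, neg_mul, h4, neg_neg]
  have h3 : γ.Γ C * γ.Γ B * γ.Γ A = -(γ.Γ A * γ.Γ B * γ.Γ C) := by
    rw [γ.anticomm hBC.symm, neg_mul, h5]
  rw [up_three, h1, h3, h4, h5, h6]
  module

lemma trace_word_mul_up_two_self {A B : Fin 10} (h : A ≠ B) :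
    (γ.word [B, A] * γ.up ![A, B]).trace = 32 := by
  have : γ.word [B, A] * γ.up ![A, B] = 1 := by
    rw [up_two_of_ne γ h, Matrix.mul_smul, word_cons, word_cons, word_nil, mul_one,
      Matrix.mul_assoc, ← Matrix.mul_assoc (γ.Γ A), γ.sq, Matrix.smul_mul, one_mul, Matrix.mul_smul,
      γ.sq, smul_smul, smul_smul]
    convert one_smul ℝ (1 : Mat32) using 2
    linear_combination eta B * eta B * eta_mul_self A + eta_mul_self B
  rw [this, Matrix.trace_one]; simp

/-- The reversed word is the inverse of the product with raised indices, so the trace is the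
dimension 32. -/
lemma trace_word_mul_up_three_self {A B C : Fin 10} (hAB : A ≠ B) (hAC : A ≠ C) (hBC : B ≠ C) :
    (γ.word [C, B, A] * γ.up ![A, B, C]).trace = 32 := by
  have : γ.word [C, B, A] * γ.up ![A, B, C] = 1 := by
    calc _ = (eta A * eta B * eta C) •
          (γ.Γ C * (γ.Γ B * (γ.Γ A * γ.Γ A) * γ.Γ B) * γ.Γ C) := by
          simp only [up_three_of_ne γ hAB hAC hBC, Matrix.mul_smul, word_cons, word_nil, mul_one,
            Matrix.mul_assoc]
      _ = (eta A * eta A * (eta B * eta B) * (eta C * eta C)) • (1 : Mat32) := by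
          simp only [γ.sq, Matrix.mul_smul, Matrix.smul_mul, mul_one, smul_smul]
          congr 1; ring
      _ = 1 := by simp only [eta_mul_self, mul_one, one_smul]
  rw [this, Matrix.trace_one]; simp

lemma trace_Γ_mul_Γ (A B : Fin 10) : (γ.Γ A * γ.Γ B).trace = if A = B then 32 * eta A else 0 := by
  split_ifs with h
  · subst h; rw [γ.sq]; simp [mul_comm]
  · have := γ.trace_word (w := [A, B]) A (by simp [Ne.symm h]; decide)
    simpa using this

/-! ### Operators that annihilate the positive chirality spinors -/

lemma eq_zero_of_slash_eq_zero {v : Fin 10 → ℝ} (h : ∀ ψ ∈ γ.plus, γ.slash v *ᵥ ψ = 0) :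
    v = 0 := by
  ext B
  have h1 := γ.trace_mul_eq_zero (W := γ.Γ B) h (by
    rw [slash, Finset.mul_sum, Finset.sum_mul, Matrix.trace_sum]
    refine Finset.sum_eq_zero fun A _ => ?_
    have := γ.trace_word_mul_chirality (w := [B, A]) (by simp) (by simp)
    rw [Matrix.mul_smul, Matrix.smul_mul, Matrix.trace_smul]
    simp only [word_cons, word_nil, mul_one] at this
    rw [this, smul_zero])
  rw [slash, Finset.mul_sum, Matrix.trace_sum] at h1
  simp only [Matrix.mul_smul, Matrix.trace_smul, trace_Γ_mul_Γ, smul_eq_mul, mul_ite, mul_zero,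
    Finset.sum_ite_eq, Finset.mem_univ, if_true] at h1
  have := eta_ne_zero B
  simpa [this] using h1

/-- Multiplying by the reversed word [B, A] and taking the trace isolates 2 · 32 · F_AB. With
chirality inserted the word part has only four letters, so no correction arises. -/
lemma eq_zero_of_two_form_eq_zero {F : Fin 10 → Fin 10 → ℝ} (hF : ∀ A B, F B A = -F A B)
    (h : ∀ ψ ∈ γ.plus, (∑ A, ∑ B, F A B • γ.up ![A, B]) *ᵥ ψ = 0) (A B : Fin 10) : F A B = 0 := by
  by_cases hAB : A = B
  · subst hAB; linarith [hF A A]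
  have h1 := γ.trace_mul_eq_zero (W := γ.word [B, A]) h (by
    simp only [Finset.mul_sum, Finset.sum_mul, Matrix.trace_sum, Matrix.mul_smul, Matrix.smul_mul,
      Matrix.trace_smul,
      γ.trace_word_mul_up_two_mul_chirality (w := [B, A]) (by simp) (by simp), smul_zero,
      Finset.sum_const_zero])
  simp only [Finset.mul_sum, Matrix.trace_sum, Matrix.mul_smul, Matrix.trace_smul, smul_eq_mul]
    at h1
  rw [sum_sum_eq_two_mul hAB (by rw [hF A B, up_two_swap γ A B]; simp)
    (fun a b ha hb => by
      rw [γ.trace_word_mul_up_two (D := A) (by simp [Ne.symm hAB]; decide) ha hb, mul_zero])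
    (fun a b ha hb => by
      rw [γ.trace_word_mul_up_two (D := B) (by simp [hAB]; decide) ha hb, mul_zero]),
    trace_word_mul_up_two_self γ hAB] at h1
  linarith

/-- Different degrees are trace-orthogonal, so testing with words of length one isolates d and
testing with words of length three isolates H; there is no cancellation between the two terms. -/
lemma eq_zero_of_one_form_add_three_form_eq_zero {d : Fin 10 → ℝ} {c : ℝ} (hc : c ≠ 0)
    {H : Fin 10 → Fin 10 → Fin 10 → ℝ} (hl : ∀ A B C, H B A C = -H A B C)
    (hr : ∀ A B C, H A C B = -H A B C)
    (h : ∀ ψ ∈ γ.plus,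
      ((∑ A, d A • γ.up ![A]) + c • ∑ A, ∑ B, ∑ C, H A B C • γ.up ![A, B, C]) *ᵥ ψ = 0) :
    d = 0 ∧ H = 0 := by
  -- The test word is odd so that w followed by one or three letters is even; fewer than seven
  -- letters keeps the total below ten.
  have key : ∀ w : List (Fin 10), Odd w.length → w.length < 7 →
      ∑ A, d A * (γ.word w * γ.up ![A]).trace +
        c * ∑ A, ∑ B, ∑ C, H A B C * (γ.word w * γ.up ![A, B, C]).trace = 0 := by
    intro w hw hw'
    have h1 : ∀ A, (γ.word w * γ.up ![A] * γ.chirality).trace = 0 := by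
      intro A
      have := γ.trace_word_mul_chirality (w := w ++ [A]) (by
        obtain ⟨k, hk⟩ := hw; exact ⟨k + 1, by simp; omega⟩) (by simp; omega)
      rw [word_append, word_cons, word_nil, mul_one] at this
      rw [up_one, Matrix.mul_smul, Matrix.smul_mul, Matrix.trace_smul, this, smul_zero]
    have h2 := γ.trace_mul_eq_zero (W := γ.word w) h (by
      simp only [Finset.mul_sum, Finset.sum_mul, Matrix.mul_add, Matrix.add_mul, Matrix.trace_add,
        Matrix.trace_sum, Matrix.mul_smul, Matrix.smul_mul, Matrix.trace_smul, h1, smul_zero,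
        γ.trace_word_mul_up_three_mul_chirality hw hw', Finset.sum_const_zero, add_zero])
    simpa only [Finset.mul_sum, Matrix.mul_add, Matrix.trace_add, Finset.smul_sum,
      Matrix.trace_sum, Matrix.mul_smul, Matrix.trace_smul, smul_eq_mul] using h2
  constructor
  · ext B
    have h1 := key [B] (by simp) (by simp)
    have h2 : ∀ a b c, H a b c * (γ.word [B] * γ.up ![a, b, c]).trace = 0 := by
      intro a b c
      by_cases hab : a = b
      · subst hab
        rw [show H a a c = 0 by linarith [hl a a c], zero_mul]
      by_cases hac : a = c
      · subst hac
        rw [show H a b a = 0 by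
          linarith [hl a b a, hr b a a, hl b a a], zero_mul]
      by_cases hbc : b = c
      · subst hbc
        rw [show H a b b = 0 by linarith [hr a b b], zero_mul]
      -- With a, b, c distinct, some letter occurs exactly once in this word of length four: b if B
      -- = a, and a otherwise. The parity is then odd.
      have : (γ.word [B, a, b, c]).trace = 0 := by
        by_cases hB : B = a
        · subst hB
          exact γ.trace_word b (by simp [hab, Ne.symm hbc]; decide)
        · exact γ.trace_word a (by simp [hB, Ne.symm hab, Ne.symm hac]; decide)
      simp only [word_cons, word_nil, mul_one] at this
      rw [up_three_of_ne γ hab hac hbc, Matrix.mul_smul, Matrix.trace_smul, word_cons, word_nil,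
        mul_one, Matrix.mul_assoc (γ.Γ a), this, smul_zero, mul_zero]
    simp only [h2, Finset.sum_const_zero, mul_zero, add_zero] at h1
    simp only [up_one, Matrix.mul_smul, Matrix.trace_smul, word_cons, word_nil, mul_one,
      trace_Γ_mul_Γ, smul_eq_mul, mul_ite] at h1
    have := eta_ne_zero B
    simpa [this] using h1
  · ext p q r
    by_cases hpq : p = q
    · subst hpq
      show H p p r = 0
      linarith [hl p p r]
    by_cases hqr : q = r
    · subst hqr
      show H p q q = 0
      linarith [hr p q q]
    by_cases hpr : p = r
    · subst hpr
      show H p q p = 0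
      linarith [hl p q p, hr q p p, hl q p p]
    have h1 := key [r, q, p] ⟨1, rfl⟩ (by simp)
    have h2 : ∀ A, (γ.word [r, q, p] * γ.up ![A]).trace = 0 := by
      intro A
      rw [up_one, Matrix.mul_smul, Matrix.trace_smul]
      have : (γ.word ([r, q, p] ++ [A])).trace = 0 := by
        by_cases hA : A = p
        · subst hA
          exact γ.trace_word q (by simp [hpq, Ne.symm hqr]; decide)
        · exact γ.trace_word p (by simp [hA, Ne.symm hpr, Ne.symm hpq]; decide)
      rw [word_append, word_cons _ A, word_nil, mul_one] at this
      rw [this, smul_zero]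
    rw [sum_sum_sum_eq_six_mul hpq hpr hqr
      (fun a b c => by rw [hl a b c, up_three_swap_left γ a b c]; simp)
      (fun a b c => by rw [hr a b c, up_three_swap_right γ a b c]; simp)
      (fun a b c ha hb hc => by
        rw [γ.trace_word_mul_up_three (D := p) (by simp [Ne.symm hpr, Ne.symm hpq]; decide) ha hb hc,
          mul_zero])
      (fun a b c ha hb hc => by
        rw [γ.trace_word_mul_up_three (D := q) (by simp [hpq, Ne.symm hqr]; decide) ha hb hc,
          mul_zero])
      (fun a b c ha hb hc => by
        rw [γ.trace_word_mul_up_three (D := r) (by simp [hpr, hqr]; decide) ha hb hc,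
          mul_zero]),
      trace_word_mul_up_three_self γ hpq hpr hqr] at h1
    simp only [h2, mul_zero, Finset.sum_const_zero, zero_add] at h1
    simpa [hc] using h1

/-! ### The invariant bilinear form on spinors -/

/-- Averaging an inner product over the group generated by the Γ_A, one generator at a time. Since
Γ_k² = ±1, the new sum is Γ_k-invariant; since generators commute up to sign and the sign enters
twice, earlier invariances persist. -/
lemma exists_posDef_invariant (s : Finset (Fin 10)) :
    ∃ P : Mat32, P.PosDef ∧ ∀ A ∈ s, (γ.Γ A)ᵀ * P * γ.Γ A = P := by
  induction s using Finset.induction with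
  | empty => exact ⟨1, Matrix.PosDef.one, by simp⟩
  | insert k s hk ih =>
    obtain ⟨P, hP, h⟩ := ih
    refine ⟨P + (γ.Γ k)ᵀ * P * γ.Γ k, hP.add_posSemidef ?_, ?_⟩
    · have := hP.posSemidef.conjTranspose_mul_mul_same (γ.Γ k)
      rwa [Matrix.conjTranspose_eq_transpose_of_trivial] at this
    · intro A hA
      rcases Finset.mem_insert.1 hA with rfl | hA
      · have h1 : (γ.Γ A)ᵀ * ((γ.Γ A)ᵀ * P * γ.Γ A) * γ.Γ A =
            (γ.Γ A * γ.Γ A)ᵀ * P * (γ.Γ A * γ.Γ A) := by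
          simp only [Matrix.transpose_mul, Matrix.mul_assoc]
        have h2 := eta_mul_self A
        rw [mul_add, add_mul, h1, γ.sq]
        simp [smul_smul, h2, add_comm]
      · have hne : A ≠ k := fun e => hk (e ▸ hA)
        have h1 : (γ.Γ A)ᵀ * ((γ.Γ k)ᵀ * P * γ.Γ k) * γ.Γ A =
            (γ.Γ k)ᵀ * P * γ.Γ k := by
          calc _ = (γ.Γ k * γ.Γ A)ᵀ * P * (γ.Γ k * γ.Γ A) := by
                simp only [Matrix.transpose_mul, Matrix.mul_assoc]
            _ = (γ.Γ A * γ.Γ k)ᵀ * P * (γ.Γ A * γ.Γ k) := by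
                rw [γ.anticomm hne]; simp
            _ = (γ.Γ k)ᵀ * ((γ.Γ A)ᵀ * P * γ.Γ A) * γ.Γ k := by
                simp only [Matrix.transpose_mul, Matrix.mul_assoc]
            _ = _ := by rw [h A hA]
        rw [mul_add, add_mul, h A hA, h1]

/-- Invariance makes Γ_A symmetric or antisymmetric for P according to the sign of η_AA, and K = P
Γ_0 makes the sign uniform. -/
lemma exists_spinor_form : ∃ K : Mat32, (∀ A, (γ.Γ A)ᵀ * K = -(K * γ.Γ A)) ∧
    ∀ v : Fin 10 → ℝ, (∀ ε₁ ∈ γ.plus, ∀ ε₂ ∈ γ.plus,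
      ∑ A, v A * (ε₁ ⬝ᵥ (K * γ.Γ A) *ᵥ ε₂) = 0) → v = 0 := by
  obtain ⟨P, hP, h⟩ := γ.exists_posDef_invariant Finset.univ
  have hA : ∀ A, (γ.Γ A)ᵀ * P = eta A • (P * γ.Γ A) := by
    intro A
    have := congrArg (· * γ.Γ A) (h A (Finset.mem_univ A))
    simp only [Matrix.mul_assoc, γ.sq, Matrix.mul_smul, mul_one] at this
    rw [← this, smul_smul, eta_mul_self, one_smul]
  refine ⟨P * γ.Γ 0, fun A => ?_, fun v hv => γ.eq_zero_of_slash_eq_zero fun ψ hψ => ?_⟩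
  · rw [← Matrix.mul_assoc, hA, Matrix.smul_mul, Matrix.mul_assoc, Matrix.mul_assoc]
    by_cases h0 : A = 0
    · subst h0; simp [eta]
    · rw [γ.anticomm h0]; simp [eta, h0]
  -- Take ε₁ = Γ_0 v̸ ψ, which has positive chirality because two gamma matrices act. The hypothesis
  -- becomes ε₁ᵀ P ε₁ = 0, so positivity gives ε₁ = 0 and hence v̸ ψ = 0.
  · have hmem : (γ.Γ 0 * γ.slash v) *ᵥ ψ ∈ γ.plus := by
      have hs : γ.slash v * γ.chirality = -(γ.chirality * γ.slash v) := by
        rw [slash, Finset.sum_mul, Finset.mul_sum, ← Finset.sum_neg_distrib]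
        simp only [Matrix.smul_mul, Matrix.mul_smul, chirality_anticomm, smul_neg]
      have hc : γ.chirality * (γ.Γ 0 * γ.slash v) = γ.Γ 0 * γ.slash v * γ.chirality := by
        rw [Matrix.mul_assoc, hs, mul_neg, ← Matrix.mul_assoc, ← Matrix.mul_assoc,
          chirality_anticomm, neg_mul, neg_neg]
      rw [mem_plus, Matrix.mulVec_mulVec, hc, ← Matrix.mulVec_mulVec, hψ]
    have h1 : ∀ ε : Fin 32 → ℝ, ∑ A, v A * (ε ⬝ᵥ (P * γ.Γ 0 * γ.Γ A) *ᵥ ψ) =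
        ε ⬝ᵥ P *ᵥ ((γ.Γ 0 * γ.slash v) *ᵥ ψ) := by
      intro ε
      rw [Matrix.mulVec_mulVec]
      simp only [slash, Finset.mul_sum, Matrix.sum_mulVec, dotProduct_sum,
        Matrix.mul_smul, Matrix.smul_mulVec, dotProduct_smul, smul_eq_mul, Matrix.mul_assoc]
    specialize h1 ((γ.Γ 0 * γ.slash v) *ᵥ ψ)
    rw [hv _ hmem _ hψ] at h1
    have h2 : (γ.Γ 0 * γ.slash v) *ᵥ ψ = 0 := by
      by_contra hne
      have := hP.dotProduct_mulVec_pos hne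
      simp only [star_trivial] at this
      linarith
    have h3 := congrArg (γ.Γ 0 *ᵥ ·) h2
    simp only [Matrix.mulVec_mulVec, ← Matrix.mul_assoc, γ.sq, Matrix.mulVec_zero,
      Matrix.smul_mul, one_mul, Matrix.smul_mulVec] at h3
    exact (smul_eq_zero.1 h3).resolve_left (eta_ne_zero 0)

/-! ### Spin connections -/

/-- The spinor representation `¼ om_{AB} Γ^{AB}` of an element of `so(1,9)`. -/
def spinRep (om : Fin 10 → Fin 10 → ℝ) : Mat32 := (1 / 4 : ℝ) • ∑ A, ∑ B, om A B • γ.up ![A, B]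

lemma up_two_commutator (A B D : Fin 10) :
    γ.up ![A, B] * γ.Γ D - γ.Γ D * γ.up ![A, B] =
      (if B = D then 2 * eta A else 0) • γ.Γ A - (if A = D then 2 * eta B else 0) • γ.Γ B := by
  have key : ∀ A B, γ.Γ A * γ.Γ B * γ.Γ D = γ.Γ D * γ.Γ A * γ.Γ B -
      (if A = D then 2 * eta A else 0) • γ.Γ B + (if B = D then 2 * eta B else 0) • γ.Γ A := by
    intro A B
    have hB := eq_sub_of_add_eq (γ.clifford B D)
    have hA := eq_sub_of_add_eq (γ.clifford A D)
    rw [Matrix.mul_assoc, hB, mul_sub, ← Matrix.mul_assoc, hA, sub_mul]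
    simp only [Matrix.mul_smul, Matrix.smul_mul, mul_one, one_mul]
    abel
  have h1 : (if B = D then 2 * eta A else 0) =
      eta A * eta B * (if B = D then 2 * eta B else 0) := by
    split_ifs
    · linear_combination (-2 * eta A) * eta_mul_self B
    · simp
  have h2 : (if A = D then 2 * eta B else 0) =
      eta A * eta B * (if A = D then 2 * eta A else 0) := by
    split_ifs
    · linear_combination (-2 * eta B) * eta_mul_self A
    · simp
  rw [up_two, Matrix.smul_mul, Matrix.mul_smul, Matrix.sub_mul, Matrix.mul_sub, key A B, key B A,
    h1, h2, ← Matrix.mul_assoc, ← Matrix.mul_assoc]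
  module

/-- The spinor representation acts on the Γ_D as the vector representation. The factor ¼ cancels two
factors 2: one from the Clifford relation, one from om_AB and om_BA contributing equally. -/
lemma spinRep_commutator {om : Fin 10 → Fin 10 → ℝ} (h : ∀ A B, om B A = -om A B) (D : Fin 10) :
    γ.spinRep om * γ.Γ D - γ.Γ D * γ.spinRep om = -∑ B, (om D B * eta B) • γ.Γ B := by
  have h1 : γ.spinRep om * γ.Γ D - γ.Γ D * γ.spinRep om = (1 / 4 : ℝ) • ∑ A, ∑ B, om A B •
      ((if B = D then 2 * eta A else 0) • γ.Γ A - (if A = D then 2 * eta B else 0) • γ.Γ B) := by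
    simp only [spinRep, Matrix.smul_mul, Matrix.mul_smul, Finset.sum_mul, Finset.mul_sum,
      ← smul_sub, ← Finset.sum_sub_distrib, up_two_commutator]
  have h2 : ∑ A, ∑ B, om A B • ((if B = D then 2 * eta A else 0) • γ.Γ A) =
      -∑ B, (2 * (om D B * eta B)) • γ.Γ B := by
    rw [← Finset.sum_neg_distrib]
    refine Finset.sum_congr rfl fun A _ => ?_
    rw [Finset.sum_eq_single D (fun B _ hB => by simp [hB]) (by simp), if_pos rfl, smul_smul,
      h D A, ← neg_smul]
    congr 1; ring
  have h3 : ∑ A, ∑ B, om A B • ((if A = D then 2 * eta B else 0) • γ.Γ B) =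
      ∑ B, (2 * (om D B * eta B)) • γ.Γ B := by
    rw [Finset.sum_eq_single D (fun A _ hA => by simp [hA]) (by simp)]
    refine Finset.sum_congr rfl fun B _ => ?_
    rw [if_pos rfl, smul_smul]
    congr 1; ring
  simp only [smul_sub, Finset.sum_sub_distrib] at h1
  rw [h1, h2, h3]
  simp only [mul_smul, ← Finset.smul_sum]
  module

lemma transpose_spinRep_mul {K : Mat32} (hK : ∀ A, (γ.Γ A)ᵀ * K = -(K * γ.Γ A))
    (om : Fin 10 → Fin 10 → ℝ) : (γ.spinRep om)ᵀ * K = -(K * γ.spinRep om) := by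
  have h1 : ∀ A B, (γ.up ![A, B])ᵀ * K = -(K * γ.up ![A, B]) := by
    intro A B
    have h2 : ∀ A B, (γ.Γ A * γ.Γ B)ᵀ * K = K * (γ.Γ B * γ.Γ A) := by
      intro A B
      rw [Matrix.transpose_mul, Matrix.mul_assoc, hK, mul_neg, ← Matrix.mul_assoc, hK, neg_mul,
        neg_neg, Matrix.mul_assoc]
    rw [up_two, Matrix.transpose_smul, Matrix.transpose_sub, Matrix.smul_mul, Matrix.sub_mul, h2,
      h2, Matrix.mul_smul, Matrix.mul_sub]
    module
  simp only [spinRep, Matrix.transpose_smul, Matrix.transpose_sum, Matrix.smul_mul, Finset.sum_mul,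
    h1, Matrix.mul_smul, Finset.mul_sum, smul_neg, Finset.sum_neg_distrib]

/-- By the product rule, the left side is the derivative of ε₁ᵀ K Γ_D ε₂ when both spinors are
parallel. The right side is the equation of a parallel covector. -/
lemma bilinear_spinRep {K : Mat32} (hK : ∀ A, (γ.Γ A)ᵀ * K = -(K * γ.Γ A))
    {om : Fin 10 → Fin 10 → ℝ} (h : ∀ A B, om B A = -om A B) (ε₁ ε₂ : Fin 32 → ℝ) (D : Fin 10) :
    (-(γ.spinRep om *ᵥ ε₁)) ⬝ᵥ (K * γ.Γ D) *ᵥ ε₂ + ε₁ ⬝ᵥ (K * γ.Γ D) *ᵥ (-(γ.spinRep om *ᵥ ε₂)) =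
      -∑ B, om D B * eta B * (ε₁ ⬝ᵥ (K * γ.Γ B) *ᵥ ε₂) := by
  have h1 : (γ.spinRep om *ᵥ ε₁) ⬝ᵥ (K * γ.Γ D) *ᵥ ε₂ =
      -(ε₁ ⬝ᵥ (K * (γ.spinRep om * γ.Γ D)) *ᵥ ε₂) := by
    rw [← Matrix.vecMul_transpose, ← Matrix.dotProduct_mulVec, Matrix.mulVec_mulVec,
      ← Matrix.mul_assoc, γ.transpose_spinRep_mul hK, neg_mul, Matrix.neg_mulVec, dotProduct_neg,
      Matrix.mul_assoc]
  have h2 : ε₁ ⬝ᵥ (K * (γ.spinRep om * γ.Γ D - γ.Γ D * γ.spinRep om)) *ᵥ ε₂ =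
      -∑ B, om D B * eta B * (ε₁ ⬝ᵥ (K * γ.Γ B) *ᵥ ε₂) := by
    rw [γ.spinRep_commutator h]
    simp only [mul_neg, Finset.mul_sum, Matrix.neg_mulVec, Matrix.sum_mulVec, dotProduct_neg,
      dotProduct_sum, Matrix.mul_smul, Matrix.smul_mulVec, dotProduct_smul, smul_eq_mul]
  rw [← h2, neg_dotProduct, h1, neg_neg, Matrix.mulVec_neg, dotProduct_neg, Matrix.mulVec_mulVec,
    Matrix.mul_sub, Matrix.sub_mulVec, dotProduct_sub, Matrix.mul_assoc K]
  ring

end GammaMatrices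

open VectorField Filter Topology

/-! ### Frames on open subsets of `ℝ¹⁰` -/

/-- `θ` is the coframe dual to the frame `e` at every point of `Ω`. -/
structure IsDualCoframe (e : Fin 10 → R10 → R10) (θ : Fin 10 → R10 → R10 →L[ℝ] ℝ) (Ω : Set R10) :
    Prop where
  apply_frame : ∀ y ∈ Ω, ∀ A B, θ A y (e B y) = if A = B then 1 else 0
  sum_smul : ∀ y ∈ Ω, ∀ v, ∑ A, θ A y v • e A y = v

/-- The map L y sends the standard basis to the frame; the coframe consists of the components of its
inverse, and inversion of linear maps is smooth. -/
lemma exists_dual_coframe {e : Fin 10 → R10 → R10} {Ω : Set R10}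
    (he : ∀ A, ContDiffOn ℝ ∞ (e A) Ω) (hli : ∀ y ∈ Ω, LinearIndependent ℝ fun A => e A y) :
    ∃ θ : Fin 10 → R10 → R10 →L[ℝ] ℝ,
      (∀ A, ContDiffOn ℝ ∞ (θ A) Ω) ∧ IsDualCoframe e θ Ω := by
  let L : R10 → R10 →L[ℝ] R10 := fun y => ∑ A, (EuclideanSpace.proj A).smulRight (e A y)
  have hLapply : ∀ y v, L y v = ∑ A, v A • e A y := fun y v => by
    simp [L]
  have hL : ContDiffOn ℝ ∞ L Ω := by
    rw [contDiffOn_clm_apply]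
    intro v
    simp only [hLapply]
    exact ContDiffOn.sum fun A _ => (he A).const_smul (v A)
  have hinj : ∀ y ∈ Ω, Function.Injective (L y) := by
    intro y hy
    rw [injective_iff_map_eq_zero]
    intro v hv
    rw [hLapply] at hv
    ext A
    exact Fintype.linearIndependent_iff.1 (hli y hy) _ hv A
  have hinv : ∀ y ∈ Ω, (L y).IsInvertible := by
    intro y hy
    refine ⟨(LinearEquiv.ofInjectiveEndo (L y : R10 →ₗ[ℝ] R10) (hinj y hy)).toContinuousLinearEquiv,
      ?_⟩
    ext v : 1
    rfl
  have hLe : ∀ y B, L y (EuclideanSpace.single B 1) = e B y := by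
    intro y B
    rw [hLapply, Finset.sum_eq_single B (fun A _ hA => by simp [hA]) (by simp)]
    simp
  refine ⟨fun A y => (EuclideanSpace.proj A).comp (L y).inverse, fun A => ?_, ⟨?_, ?_⟩⟩
  · refine contDiffOn_const.clm_comp fun y hy => ?_
    exact ((hinv y hy).contDiffAt_map_inverse).comp_contDiffWithinAt y (hL y hy)
  · intro y hy A B
    have : (L y).inverse (e B y) = EuclideanSpace.single B 1 := by
      apply hinj y hy
      rw [(hinv y hy).self_apply_inverse, hLe]
    simp [this]
  · intro y hy v
    have := hLapply y ((L y).inverse v)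
    rw [(hinv y hy).self_apply_inverse] at this
    exact this.symm

namespace IsDualCoframe

variable {e : Fin 10 → R10 → R10} {θ : Fin 10 → R10 → R10 →L[ℝ] ℝ} {Ω : Set R10}

lemma map_eq {V : Type*} [AddCommGroup V] [Module ℝ V] [TopologicalSpace V]
    (hθ : IsDualCoframe e θ Ω) {y : R10} (hy : y ∈ Ω)
    (L : R10 →L[ℝ] V) (v : R10) : L v = ∑ A, θ A y v • L (e A y) := by
  conv_lhs => rw [← hθ.sum_smul y hy v]
  simp only [map_sum, map_smul]

end IsDualCoframe

/-! ### Linear differential equations along a frame -/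

/-- Grönwall's inequality along the rays from x₀ in a small ball. -/
lemma eventually_eq_zero_of_norm_fderiv_le {G : Type*} [NormedAddCommGroup G] [NormedSpace ℝ G]
    {F : R10 → G} {x₀ : R10} {K : ℝ} (hd : ∀ᶠ y in 𝓝 x₀, DifferentiableAt ℝ F y)
    (hK : ∀ᶠ y in 𝓝 x₀, ∀ v, ‖fderiv ℝ F y v‖ ≤ K * ‖v‖ * ‖F y‖) (h0 : F x₀ = 0) :
    ∀ᶠ y in 𝓝 x₀, F y = 0 := by
  obtain ⟨r, hr, hball⟩ := Metric.eventually_nhds_iff_ball.1 (hd.and hK)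
  refine Metric.eventually_nhds_iff_ball.2 ⟨r, hr, fun y hy => ?_⟩
  have hmem : ∀ t ∈ Set.Icc (0 : ℝ) 1, x₀ + t • (y - x₀) ∈ Metric.ball x₀ r := by
    intro t ht
    exact (convex_ball x₀ r).add_smul_sub_mem (Metric.mem_ball_self hr) hy ht
  have hder : ∀ t ∈ Set.Icc (0 : ℝ) 1, HasDerivAt (fun t : ℝ => F (x₀ + t • (y - x₀)))
      (fderiv ℝ F (x₀ + t • (y - x₀)) (y - x₀)) t := by
    intro t ht
    have h1 : HasDerivAt (fun t : ℝ => x₀ + t • (y - x₀)) (y - x₀) t := by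
      simpa using ((hasDerivAt_id t).smul_const (y - x₀)).const_add x₀
    exact (hball _ (hmem t ht)).1.hasFDerivAt.comp_hasDerivAt t h1
  have := eq_zero_of_abs_deriv_le_mul_abs_self_of_eq_zero_right (a := 0) (b := 1)
    (K := K * ‖y - x₀‖)
    (fun t ht => (hder t ht).continuousAt.continuousWithinAt)
    (fun t ht => (hder t (Set.Ico_subset_Icc_self ht)).hasDerivWithinAt)
    (by simpa using h0)
    (fun t ht => (hball _ (hmem t (Set.Ico_subset_Icc_self ht))).2 _) 1 (by simp)
  simpa using this

lemma norm_mulVec_le (B : Mat32) (w : Fin 32 → ℝ) : ‖B *ᵥ w‖ ≤ (∑ a, ∑ b, |B a b|) * ‖w‖ := by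
  refine (pi_norm_le_iff_of_nonneg (by positivity)).2 fun a => ?_
  calc ‖(B *ᵥ w) a‖ ≤ ∑ b, ‖B a b * w b‖ := norm_sum_le Finset.univ fun b => B a b * w b
    _ ≤ ∑ b, |B a b| * ‖w‖ := by
        refine Finset.sum_le_sum fun b _ => ?_
        rw [norm_mul, Real.norm_eq_abs]
        exact mul_le_mul_of_nonneg_left (norm_le_pi_norm w b) (abs_nonneg _)
    _ = (∑ b, |B a b|) * ‖w‖ := by rw [Finset.sum_mul]
    _ ≤ _ := by
        refine mul_le_mul_of_nonneg_right ?_ (norm_nonneg _)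
        exact Finset.single_le_sum (f := fun a => ∑ b, |B a b|)
          (fun a _ => Finset.sum_nonneg fun b _ => abs_nonneg _) (Finset.mem_univ a)

lemma eventually_eq_zero_of_frame {e : Fin 10 → R10 → R10} {θ : Fin 10 → R10 → R10 →L[ℝ] ℝ}
    {Ω : Set R10} (hΩ : IsOpen Ω) (hθ : IsDualCoframe e θ Ω) (hθc : ∀ A, ContinuousOn (θ A) Ω)
    {F : R10 → Fin 32 → ℝ} (hF : DifferentiableOn ℝ F Ω) {B : Fin 10 → R10 → Mat32}
    (hB : ∀ C a b, ContinuousOn (fun y => B C y a b) Ω)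
    (h : ∀ y ∈ Ω, ∀ C, fderiv ℝ F y (e C y) = -(B C y *ᵥ F y)) {x₀ : R10} (hx₀ : x₀ ∈ Ω)
    (h0 : F x₀ = 0) : ∀ᶠ y in 𝓝 x₀, F y = 0 := by
  have hΩn := hΩ.mem_nhds hx₀
  let N : R10 → ℝ := fun y => ∑ C, ‖θ C y‖ * ∑ a, ∑ b, |B C y a b|
  have hN : ContinuousAt N x₀ := by
    refine ContinuousOn.continuousAt ?_ hΩn
    exact continuousOn_finsetSum _ fun C _ => (hθc C).norm.mul
      (continuousOn_finsetSum _ fun a _ => continuousOn_finsetSum _ fun b _ => (hB C a b).abs)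
  have hN' : ∀ᶠ y in 𝓝 x₀, N y < N x₀ + 1 := hN.eventually_lt_const (by linarith)
  refine eventually_eq_zero_of_norm_fderiv_le (K := N x₀ + 1) ?_ ?_ h0
  · filter_upwards [hΩn] with y hy using hF.differentiableAt (hΩ.mem_nhds hy)
  · filter_upwards [hΩn, hN'] with y hy hNy v
    calc ‖fderiv ℝ F y v‖ = ‖∑ C, θ C y v • fderiv ℝ F y (e C y)‖ := by rw [hθ.map_eq hy]
      _ ≤ ∑ C, ‖θ C y v • fderiv ℝ F y (e C y)‖ := norm_sum_le _ _
      _ ≤ ∑ C, ‖θ C y‖ * ‖v‖ * ((∑ a, ∑ b, |B C y a b|) * ‖F y‖) := by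
          refine Finset.sum_le_sum fun C _ => ?_
          rw [norm_smul, h y hy, norm_neg]
          exact mul_le_mul ((θ C y).le_opNorm v) (norm_mulVec_le _ _) (norm_nonneg _)
            (by positivity)
      _ = N y * ‖v‖ * ‖F y‖ := by
          simp only [N, Finset.sum_mul]
          exact Finset.sum_congr rfl fun C _ => by
            simp only [mul_assoc, Finset.mul_sum, Finset.sum_mul]
            refine Finset.sum_congr rfl fun a _ => Finset.sum_congr rfl fun b _ => by ring
      _ ≤ _ := by gcongr

/-! ### Closed one-forms and flat coordinates -/

/-- The hypothesis is dα(e_C, e_D) = 0 in Cartan's form. In the product rule the derivatives of the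
frame cancel the bracket term, leaving symmetry on frame vectors, which extends by linearity. -/
lemma fderiv_symm_of_frame {e : Fin 10 → R10 → R10} {θ : Fin 10 → R10 → R10 →L[ℝ] ℝ}
    {Ω : Set R10} (hθ : IsDualCoframe e θ Ω) {y : R10} (hy : y ∈ Ω) {α : R10 → R10 →L[ℝ] ℝ}
    (hα : DifferentiableAt ℝ α y) (he : ∀ C, DifferentiableAt ℝ (e C) y)
    (h : ∀ C D, fderiv ℝ (fun z => α z (e D z)) y (e C y) -
      fderiv ℝ (fun z => α z (e C z)) y (e D y) = α y (lieBracket ℝ (e C) (e D) y)) (u v : R10) :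
    fderiv ℝ α y u v = fderiv ℝ α y v u := by
  have key : ∀ C D, fderiv ℝ α y (e C y) (e D y) = fderiv ℝ α y (e D y) (e C y) := by
    intro C D
    have := h C D
    rw [fderiv_clm_apply hα (he D), fderiv_clm_apply hα (he C), lieBracket_eq] at this
    simp at this
    linarith
  rw [hθ.map_eq hy (fderiv ℝ α y) u, hθ.map_eq hy (fderiv ℝ α y) v]
  simp only [sum_apply, smul_apply]
  have h1 : ∀ C w, fderiv ℝ α y (e C y) w = ∑ D, θ D y w • fderiv ℝ α y (e C y) (e D y) :=
    fun C w => hθ.map_eq hy _ w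
  simp only [h1 _ u, h1 _ v, Finset.smul_sum]
  rw [Finset.sum_comm]
  refine Finset.sum_congr rfl fun D _ => Finset.sum_congr rfl fun C _ => ?_
  rw [key C D, smul_comm]

/-- The Levi-Civita coefficients in a frame `e` that is orthonormal for the metric
`∑ A, η_{AA} θ^A ⊗ θ^A`. -/
def frameConnection (e : Fin 10 → R10 → R10) (θ : Fin 10 → R10 → R10 →L[ℝ] ℝ) (y : R10)
    (C A B : Fin 10) : ℝ :=
  (1 / 2) * (eta A * θ A y (lieBracket ℝ (e C) (e B) y) -
    eta B * θ B y (lieBracket ℝ (e C) (e A) y) - eta C * θ C y (lieBracket ℝ (e B) (e A) y))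

section FlatCoordinates

variable {e : Fin 10 → R10 → R10} {θ : Fin 10 → R10 → R10 →L[ℝ] ℝ} {Ω : Set R10}

lemma frameConnection_antisymm (y : R10) (C A B : Fin 10) :
    frameConnection e θ y C B A = -frameConnection e θ y C A B := by
  have : lieBracket ℝ (e A) (e B) y = -lieBracket ℝ (e B) (e A) y := lieBracket_swap
  rw [frameConnection, frameConnection, this, map_neg]
  ring

lemma frameConnection_torsion (y : R10) (C D E : Fin 10) :
    frameConnection e θ y C D E - frameConnection e θ y D C E =
      -(eta E * θ E y (lieBracket ℝ (e C) (e D) y)) := by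
  have h1 : lieBracket ℝ (e D) (e E) y = -lieBracket ℝ (e E) (e D) y := lieBracket_swap
  have h2 : lieBracket ℝ (e C) (e E) y = -lieBracket ℝ (e E) (e C) y := lieBracket_swap
  have h3 : lieBracket ℝ (e D) (e C) y = -lieBracket ℝ (e C) (e D) y := lieBracket_swap
  rw [frameConnection, frameConnection, h1, h2, h3]
  simp only [map_neg]
  ring

variable {W : Fin 10 → Fin 10 → R10 → ℝ}

/-- Antisymmetry of the connection in its last two indices (metric compatibility) makes inner
products of parallel covectors constant on the convex set, so their values at x₀ decide. -/
lemma gram_of_parallel (hΩ : IsOpen Ω) (hc : Convex ℝ Ω) (hθ : IsDualCoframe e θ Ω)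
    (hW : ∀ a D, DifferentiableOn ℝ (W a D) Ω)
    (hp : ∀ y ∈ Ω, ∀ a C D, fderiv ℝ (W a D) y (e C y) =
      -∑ E, frameConnection e θ y C D E * eta E * W a E y)
    {x₀ : R10} (hx₀ : x₀ ∈ Ω) (h0 : ∀ a D, W a D x₀ = if a = D then 1 else 0) {y : R10}
    (hy : y ∈ Ω) (a b : Fin 10) :
    ∑ D, eta D * W a D y * W b D y = if a = b then eta a else 0 := by
  have hWat : ∀ z ∈ Ω, ∀ a D, DifferentiableAt ℝ (W a D) z := fun z hz a D =>
    (hW a D).differentiableAt (hΩ.mem_nhds hz)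
  have hd : ∀ z ∈ Ω, HasFDerivAt (fun z => ∑ D, eta D * W a D z * W b D z)
      (∑ D, ((eta D * W a D z) • fderiv ℝ (W b D) z +
        W b D z • (eta D • fderiv ℝ (W a D) z))) z := fun z hz =>
    HasFDerivAt.fun_sum fun D _ => ((hWat z hz a D).hasFDerivAt.const_mul (eta D)).mul
      (hWat z hz b D).hasFDerivAt
  have hconst := hΩ.is_const_of_fderiv_eq_zero (𝕜 := ℝ) hc.isPreconnected
    (fun z hz => (hd z hz).differentiableAt.differentiableWithinAt) (fun z hz => ?_) hy hx₀
  · refine hconst.trans ?_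
    simp only [h0, mul_ite, mul_one, mul_zero]
    by_cases hab : a = b
    · simp [hab]
    · simp [hab]
  · rw [(hd z hz).fderiv]
    ext v
    rw [hθ.map_eq hz]
    refine Finset.sum_eq_zero fun C _ => ?_
    have : (∑ D, ((eta D * W a D z) • fderiv ℝ (W b D) z +
        W b D z • (eta D • fderiv ℝ (W a D) z))) (e C z) = 0 := by
      simp only [sum_apply, add_apply, smul_apply, hp z hz, smul_eq_mul, Finset.sum_add_distrib,
        mul_neg, Finset.mul_sum, Finset.sum_neg_distrib]
      nth_rewrite 2 [Finset.sum_comm]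
      rw [← neg_add, ← Finset.sum_add_distrib, neg_eq_zero]
      refine Finset.sum_eq_zero fun D _ => ?_
      rw [← Finset.sum_add_distrib]
      refine Finset.sum_eq_zero fun E _ => ?_
      rw [frameConnection_antisymm z C D E]
      ring
    rw [this, smul_zero]

/-- A parallel one-form is closed because the connection has no torsion; the Poincaré lemma on the
convex set supplies the primitive. -/
lemma exists_primitive_of_parallel (hΩ : IsOpen Ω) (hc : Convex ℝ Ω)
    (he : ∀ A, ContDiffOn ℝ ∞ (e A) Ω) (hθs : ∀ A, ContDiffOn ℝ ∞ (θ A) Ω)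
    (hθ : IsDualCoframe e θ Ω) (hW : ∀ a D, ContDiffOn ℝ ∞ (W a D) Ω)
    (hp : ∀ y ∈ Ω, ∀ a C D, fderiv ℝ (W a D) y (e C y) =
      -∑ E, frameConnection e θ y C D E * eta E * W a E y) (a : Fin 10) :
    ∃ f : R10 → ℝ, ContDiffOn ℝ ∞ f Ω ∧ ∀ y ∈ Ω, HasFDerivAt f (∑ D, W a D y • θ D y) y := by
  let α : R10 → R10 →L[ℝ] ℝ := fun y => ∑ D, W a D y • θ D y
  have hα : ContDiffOn ℝ ∞ α Ω := ContDiffOn.sum fun D _ => (hW a D).smul (hθs D)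
  have hαd : DifferentiableOn ℝ α Ω := hα.differentiableOn (by simp)
  have hαe : ∀ y ∈ Ω, ∀ C, α y (e C y) = W a C y := by
    intro y hy C
    simp [α, hθ.apply_frame y hy]
  obtain ⟨f, hf⟩ := hc.exists_forall_hasFDerivAt_of_fderiv_symmetric hΩ hαd
    (fun y hy u v => by
      refine fderiv_symm_of_frame hθ hy (hαd.differentiableAt (hΩ.mem_nhds hy))
        (fun C => ((he C).differentiableOn (by simp)).differentiableAt (hΩ.mem_nhds hy))
        (fun C D => ?_) u v
      have h1 : ∀ C, fderiv ℝ (fun z => α z (e C z)) y = fderiv ℝ (W a C) y := fun C =>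
        Filter.EventuallyEq.fderiv_eq (by
          filter_upwards [hΩ.mem_nhds hy] with z hz using hαe z hz C)
      rw [h1, h1, hp y hy, hp y hy, neg_sub_neg, ← Finset.sum_sub_distrib]
      simp only [α, sum_apply, smul_apply, smul_eq_mul]
      refine Finset.sum_congr rfl fun E _ => ?_
      have h2 := frameConnection_torsion (e := e) (θ := θ) y C D E
      have h3 := eta_mul_self E
      linear_combination (-eta E * W a E y) * h2 +
        (W a E y * θ E y (lieBracket ℝ (e C) (e D) y)) * h3)
  refine ⟨f, (contDiffOn_infty_iff_fderiv_of_isOpen hΩ).2 ⟨fun y hy =>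
    (hf y hy).differentiableAt.differentiableWithinAt, hα.congr fun y hy => (hf y hy).fderiv⟩, hf⟩

theorem exists_flat_coordinates (hΩ : IsOpen Ω) (hc : Convex ℝ Ω)
    (he : ∀ A, ContDiffOn ℝ ∞ (e A) Ω) (hθs : ∀ A, ContDiffOn ℝ ∞ (θ A) Ω)
    (hθ : IsDualCoframe e θ Ω) (hW : ∀ a D, ContDiffOn ℝ ∞ (W a D) Ω)
    (hp : ∀ y ∈ Ω, ∀ a C D, fderiv ℝ (W a D) y (e C y) =
      -∑ E, frameConnection e θ y C D E * eta E * W a E y)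
    {x₀ : R10} (hx₀ : x₀ ∈ Ω) (h0 : ∀ a D, W a D x₀ = if a = D then 1 else 0) :
    ∃ f : R10 → R10, ContDiffOn ℝ ∞ f Ω ∧ ∀ y ∈ Ω, ∀ u v,
      minkowski (fderiv ℝ f y u) (fderiv ℝ f y v) = ∑ A, eta A * θ A y u * θ A y v := by
  choose f hfs hf using exists_primitive_of_parallel hΩ hc he hθs hθ hW hp
  refine ⟨fun y => WithLp.toLp 2 fun a => f a y, contDiffOn_euclidean.2 fun a => hfs a, ?_⟩
  intro y hy u v
  have hd : HasFDerivAt (fun y => (WithLp.toLp 2 fun a => f a y : R10))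
      ((EuclideanSpace.equiv (Fin 10) ℝ).symm.toContinuousLinearMap.comp
        (ContinuousLinearMap.pi fun a => ∑ D, W a D y • θ D y)) y := by
    rw [← hasFDerivWithinAt_univ, hasFDerivWithinAt_euclidean]
    intro a
    exact (hf a y hy).hasFDerivWithinAt
  have happly : ∀ w a, fderiv ℝ (fun y => (WithLp.toLp 2 fun a => f a y : R10)) y w a =
      ∑ D, W a D y * θ D y w := by
    intro w a
    rw [hd.fderiv]
    simp
  let X : Matrix (Fin 10) (Fin 10) ℝ := Matrix.of fun a D => W a D y
  let η : Matrix (Fin 10) (Fin 10) ℝ := Matrix.diagonal eta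
  have hη : η * η = 1 := by
    simp [η, Matrix.diagonal_mul_diagonal, eta_mul_self]
  have h1 : X * η * Xᵀ = η := by
    ext a b
    rw [Matrix.mul_apply]
    simp only [η, Matrix.mul_diagonal, Matrix.transpose_apply, Matrix.diagonal_apply]
    rw [← gram_of_parallel hΩ hc hθ (fun a D => (hW a D).differentiableOn (by simp)) hp hx₀ h0 hy a b]
    exact Finset.sum_congr rfl fun D _ => by simp only [X, Matrix.of_apply]; ring
  -- `gram_of_parallel` gives X η Xᵀ = η, but the pullback metric needs the transposed relation. It
  -- follows because a right inverse of a square matrix is also a left inverse.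
  have h2 : Xᵀ * η * X = η := by
    have h3 : X * (η * Xᵀ * η) = 1 := by
      rw [← Matrix.mul_assoc, ← Matrix.mul_assoc, h1, hη]
    have h4 : (η * Xᵀ * η) * X = 1 := mul_eq_one_comm.1 h3
    calc Xᵀ * η * X = η * ((η * Xᵀ * η) * X) := by
          rw [Matrix.mul_assoc η, Matrix.mul_assoc η, ← Matrix.mul_assoc η, hη, one_mul]
      _ = η := by rw [h4, mul_one]
  have h3 : ∀ D E, ∑ a, eta a * W a D y * W a E y = if D = E then eta D else 0 := by
    intro D E
    have := congrFun (congrFun h2 D) E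
    rw [Matrix.mul_apply] at this
    simp only [η, Matrix.mul_diagonal, Matrix.transpose_apply, Matrix.diagonal_apply] at this
    rw [← this]
    exact Finset.sum_congr rfl fun a _ => by simp only [X, Matrix.of_apply]; ring
  simp only [minkowski, happly]
  calc ∑ a, eta a * (∑ D, W a D y * θ D y u) * ∑ E, W a E y * θ E y v
      = ∑ a, ∑ D, ∑ E, (eta a * W a D y * W a E y) * (θ D y u * θ E y v) := by
        refine Finset.sum_congr rfl fun a _ => ?_
        rw [mul_assoc, Finset.sum_mul_sum, Finset.mul_sum]
        refine Finset.sum_congr rfl fun D _ => ?_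
        rw [Finset.mul_sum]
        exact Finset.sum_congr rfl fun E _ => by ring
    _ = ∑ D, ∑ E, (∑ a, eta a * W a D y * W a E y) * (θ D y u * θ E y v) := by
        rw [Finset.sum_comm]
        refine Finset.sum_congr rfl fun D _ => ?_
        rw [Finset.sum_comm]
        exact Finset.sum_congr rfl fun E _ => by rw [Finset.sum_mul]
    _ = _ := by
        simp only [h3, ite_mul, zero_mul, Finset.sum_ite_eq, Finset.mem_univ, if_true]
        simp only [mul_assoc]

end FlatCoordinates

section Chart

variable {M : Type*} [TopologicalSpace M] [ChartedSpace R10 M]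

/-! ### Passing to a chart -/

/-- The inverse of the preferred chart at `x₀`. -/
def chartInv (x₀ : M) : R10 → M := (extChartAt (𝓡 10) x₀).symm

/-- The domain in `ℝ¹⁰` of the inverse chart at `x₀`, restricted to the preimage of `O`. -/
def chartDomain (x₀ : M) (O : Set M) : Set R10 :=
  (extChartAt (𝓡 10) x₀).target ∩ chartInv x₀ ⁻¹' O

/-- The coordinate expression of a vector field. -/
def chartField (x₀ : M) (X : VField M) : R10 → R10 :=
  mpullback 𝓘(ℝ, R10) (𝓡 10) (chartInv x₀) X

variable {x₀ : M} {O : Set M} {y : R10}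

lemma isOpen_chartDomain (hO : IsOpen O) : IsOpen (chartDomain x₀ O) :=
  (continuousOn_extChartAt_symm x₀).isOpen_inter_preimage (isOpen_extChartAt_target x₀) hO

variable [IsManifold (𝓡 10) ∞ M]

lemma contMDiffOn_chartInv :
    ContMDiffOn 𝓘(ℝ, R10) (𝓡 10) ∞ (chartInv x₀) (extChartAt (𝓡 10) x₀).target :=
  contMDiffOn_extChartAt_symm x₀

lemma contMDiffAt_chartInv (hy : y ∈ chartDomain x₀ O) :
    ContMDiffAt 𝓘(ℝ, R10) (𝓡 10) ∞ (chartInv x₀) y :=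
  contMDiffOn_chartInv.contMDiffAt ((isOpen_extChartAt_target x₀).mem_nhds hy.1)

lemma isInvertible_mfderiv_chartInv (hy : y ∈ chartDomain x₀ O) :
    (mfderiv 𝓘(ℝ, R10) (𝓡 10) (chartInv x₀) y).IsInvertible := by
  have : IsManifold (𝓡 10) 1 M := IsManifold.of_le (n := ∞) (by simp)
  have := isInvertible_mfderivWithin_extChartAt_symm (I := 𝓡 10) hy.1
  rwa [ModelWithCorners.range_eq_univ, mfderivWithin_univ] at this

lemma mfderiv_chartInv_chartField (X : VField M) (hy : y ∈ chartDomain x₀ O) :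
    mfderiv 𝓘(ℝ, R10) (𝓡 10) (chartInv x₀) y (chartField x₀ X y) = X (chartInv x₀ y) :=
  (isInvertible_mfderiv_chartInv hy).self_apply_inverse _

lemma contDiffOn_comp_chartInv {f : M → ℝ} (hf : SmoothFunOn f O) :
    ContDiffOn ℝ ∞ (fun y => f (chartInv x₀ y)) (chartDomain x₀ O) :=
  (ContMDiffOn.comp hf (contMDiffOn_chartInv.mono Set.inter_subset_left)
    fun _ h => h.2).contDiffOn

lemma fderiv_comp_chartInv {f : M → ℝ} (hO : IsOpen O) (hf : SmoothFunOn f O) (X : VField M)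
    (hy : y ∈ chartDomain x₀ O) :
    fderiv ℝ (fun y => f (chartInv x₀ y)) y (chartField x₀ X y) =
      dirDeriv f (chartInv x₀ y) (X (chartInv x₀ y)) := by
  have h1 : MDifferentiableAt (𝓡 10) 𝓘(ℝ, ℝ) f (chartInv x₀ y) :=
    (hf.contMDiffAt (hO.mem_nhds hy.2)).mdifferentiableAt (by simp)
  have h2 := (contMDiffAt_chartInv hy).mdifferentiableAt (by simp)
  have h3 := mfderiv_comp y h1 h2
  rw [mfderiv_eq_fderiv] at h3
  rw [dirDeriv, ← mfderiv_chartInv_chartField X hy]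
  exact congrArg (fun L : R10 →L[ℝ] ℝ => L (chartField x₀ X y)) h3

lemma contDiffOn_chartField {X : VField M} (hO : IsOpen O) (hX : SmoothVFieldOn X O) :
    ContDiffOn ℝ ∞ (chartField x₀ X) (chartDomain x₀ O) := by
  intro y hy
  refine ContDiffAt.contDiffWithinAt (contMDiffAt_vectorSpace_iff_contDiffAt.1 ?_)
  exact ContMDiffAt.mpullback_vectorField_preimage (hX.contMDiffAt (hO.mem_nhds hy.2))
    (contMDiffAt_chartInv hy) (isInvertible_mfderiv_chartInv hy) (by simp)

lemma lieBracket_chartField {X Y : VField M} (hO : IsOpen O) (hX : SmoothVFieldOn X O)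
    (hY : SmoothVFieldOn Y O) (hy : y ∈ chartDomain x₀ O) :
    lieBracket ℝ (chartField x₀ X) (chartField x₀ Y) y =
      chartField x₀ (mlieBracket (𝓡 10) X Y) y := by
  have h2 : minSmoothness ℝ 2 ≤ (∞ : WithTop ℕ∞) := by
    rw [minSmoothness_of_isRCLikeNormedField]; exact WithTop.coe_le_coe.2 le_top
  have : IsManifold (𝓡 10) (minSmoothness ℝ 2) M := IsManifold.of_le h2
  have h := mpullback_mlieBracket (I := 𝓘(ℝ, R10)) (I' := 𝓡 10) (n := ∞) (f := chartInv x₀) (x₀ := y)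
    ((hX.contMDiffAt (hO.mem_nhds hy.2)).mdifferentiableAt (by simp))
    ((hY.contMDiffAt (hO.mem_nhds hy.2)).mdifferentiableAt (by simp))
    (contMDiffAt_chartInv hy) h2
  refine Eq.trans ?_ h.symm
  rw [← mlieBracketWithin_univ, mlieBracketWithin_eq_lieBracketWithin]
  exact (congrFun lieBracketWithin_univ y).symm

end Chart

section OrthonormalFrame

variable {M : Type*} [TopologicalSpace M] [ChartedSpace R10 M] [IsManifold (𝓡 10) ∞ M]

/-! ### Smooth orthonormal frames -/

/-- `e` is a smooth orthonormal frame on the open set `O`. -/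
structure IsOrthonormalFrame (g : LorentzMetric M) (e : Fin 10 → VField M) (O : Set M) : Prop where
  isOpen : IsOpen O
  smooth : ∀ A, SmoothVFieldOn (e A) O
  orthonormal : ∀ x ∈ O, ∀ A B, g.g x (e A x) (e B x) = if A = B then eta A else 0

namespace IsOrthonormalFrame

variable {g : LorentzMetric M} {e : Fin 10 → VField M} {O : Set M}

lemma linearIndependent (h : IsOrthonormalFrame g e O) {x : M} (hx : x ∈ O) :
    LinearIndependent ℝ fun A => e A x := by
  rw [Fintype.linearIndependent_iff]
  intro c hc B
  have h1 : g.g x (e B x) (∑ A, c A • e A x) = c B * eta B := by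
    simp [map_sum, map_smul, h.orthonormal x hx]
  rw [hc, map_zero] at h1
  exact (mul_eq_zero.1 h1.symm).resolve_right (eta_ne_zero B)

lemma linearIndependent_chartField (h : IsOrthonormalFrame g e O) (x₀ : M) {y : R10}
    (hy : y ∈ chartDomain x₀ O) : LinearIndependent ℝ fun A => chartField x₀ (e A) y := by
  refine LinearIndependent.of_comp
    (mfderiv 𝓘(ℝ, R10) (𝓡 10) (chartInv x₀) y : R10 →L[ℝ] R10).toLinearMap ?_
  have : (fun A => (mfderiv 𝓘(ℝ, R10) (𝓡 10) (chartInv x₀) y) (chartField x₀ (e A) y)) =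
      fun A => e A (chartInv x₀ y) := by
    funext A
    exact mfderiv_chartInv_chartField (e A) hy
  have h1 := h.linearIndependent hy.2
  rw [← this] at h1
  exact h1

lemma contDiffOn_chartField (h : IsOrthonormalFrame g e O) (x₀ : M) (A : Fin 10) :
    ContDiffOn ℝ ∞ (chartField x₀ (e A)) (chartDomain x₀ O) :=
  Sugra.contDiffOn_chartField h.isOpen (h.smooth A)

lemma exists_dual_coframe (h : IsOrthonormalFrame g e O) (x₀ : M) :
    ∃ θ : Fin 10 → R10 → R10 →L[ℝ] ℝ, (∀ A, ContDiffOn ℝ ∞ (θ A) (chartDomain x₀ O)) ∧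
      IsDualCoframe (fun A => chartField x₀ (e A)) θ (chartDomain x₀ O) :=
  Sugra.exists_dual_coframe (h.contDiffOn_chartField x₀) fun _ hy =>
    h.linearIndependent_chartField x₀ hy

variable {x₀ : M} {θ : Fin 10 → R10 → R10 →L[ℝ] ℝ} {y : R10}

lemma mfderiv_chartInv_eq (hθ : IsDualCoframe (fun A => chartField x₀ (e A)) θ (chartDomain x₀ O))
    (hy : y ∈ chartDomain x₀ O) (u : R10) :
    mfderiv 𝓘(ℝ, R10) (𝓡 10) (chartInv x₀) y u = ∑ A, θ A y u • e A (chartInv x₀ y) := by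
  have h1 := hθ.map_eq hy (mfderiv 𝓘(ℝ, R10) (𝓡 10) (chartInv x₀) y : R10 →L[ℝ] R10) u
  refine h1.trans (Finset.sum_congr rfl fun A _ => ?_)
  exact congrArg (θ A y u • ·) (mfderiv_chartInv_chartField (e A) hy)

lemma metric_chartInv_frame (h : IsOrthonormalFrame g e O)
    (hθ : IsDualCoframe (fun A => chartField x₀ (e A)) θ (chartDomain x₀ O))
    (hy : y ∈ chartDomain x₀ O) (u : R10) (B : Fin 10) :
    g.g (chartInv x₀ y) (mfderiv 𝓘(ℝ, R10) (𝓡 10) (chartInv x₀) y u) (e B (chartInv x₀ y)) =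
      eta B * θ B y u := by
  rw [mfderiv_chartInv_eq hθ hy]
  simp [map_sum, map_smul, LinearMap.sum_apply, h.orthonormal _ hy.2, mul_comm]

lemma metric_chartInv (h : IsOrthonormalFrame g e O)
    (hθ : IsDualCoframe (fun A => chartField x₀ (e A)) θ (chartDomain x₀ O))
    (hy : y ∈ chartDomain x₀ O) (u v : R10) :
    g.g (chartInv x₀ y) (mfderiv 𝓘(ℝ, R10) (𝓡 10) (chartInv x₀) y u)
      (mfderiv 𝓘(ℝ, R10) (𝓡 10) (chartInv x₀) y v) = ∑ A, eta A * θ A y u * θ A y v := by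
  rw [mfderiv_chartInv_eq hθ hy v, map_sum]
  simp only [map_smul, h.metric_chartInv_frame hθ hy, smul_eq_mul]
  exact Finset.sum_congr rfl fun A _ => by ring

/-- In an orthonormal frame the Koszul formula involves only Lie brackets and frame components, and
brackets are natural under pullback by the chart. -/
lemma leviCivita_chartInv (h : IsOrthonormalFrame g e O)
    (hθ : IsDualCoframe (fun A => chartField x₀ (e A)) θ (chartDomain x₀ O))
    (hy : y ∈ chartDomain x₀ O) (C A B : Fin 10) :
    leviCivita g e (chartInv x₀ y) C A B =
      frameConnection (fun A => chartField x₀ (e A)) θ y C A B := by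
  have key : ∀ C B A, g.g (chartInv x₀ y) (mlieBracket (𝓡 10) (e C) (e B) (chartInv x₀ y))
      (e A (chartInv x₀ y)) =
      eta A * θ A y (lieBracket ℝ (chartField x₀ (e C)) (chartField x₀ (e B)) y) := by
    intro C B A
    rw [lieBracket_chartField h.isOpen (h.smooth C) (h.smooth B) hy,
      ← h.metric_chartInv_frame hθ hy, mfderiv_chartInv_chartField _ hy]
  rw [leviCivita, frameConnection, key, key, key]

end IsOrthonormalFrame

lemma continuousOn_frameConnection {e : Fin 10 → R10 → R10} {θ : Fin 10 → R10 → R10 →L[ℝ] ℝ}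
    {Ω : Set R10} (hΩ : IsOpen Ω) (he : ∀ A, ContDiffOn ℝ ∞ (e A) Ω)
    (hθ : ∀ A, ContDiffOn ℝ ∞ (θ A) Ω) (C A B : Fin 10) :
    ContinuousOn (fun y => frameConnection e θ y C A B) Ω := by
  have h1 : ∀ C B, ContinuousOn (fun y => lieBracket ℝ (e C) (e B) y) Ω := by
    intro C B
    have h2 : ∀ A, ContinuousOn (fderiv ℝ (e A)) Ω := fun A =>
      (he A).continuousOn_fderiv_of_isOpen hΩ (by simp)
    exact ((h2 B).clm_apply (he C).continuousOn).sub ((h2 C).clm_apply (he B).continuousOn)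
  have h2 : ∀ A C B, ContinuousOn (fun y => eta A * θ A y (lieBracket ℝ (e C) (e B) y)) Ω :=
    fun A C B => continuousOn_const.mul ((hθ A).continuousOn.clm_apply (h1 C B))
  exact continuousOn_const.mul (((h2 A C B).sub (h2 B C A)).sub (h2 C B A))

end OrthonormalFrame

section Supersymmetry

variable {M : Type*} [TopologicalSpace M] [ChartedSpace R10 M] [IsManifold (𝓡 10) ∞ M]

namespace Background

variable {γ : GammaMatrices} {N : ℕ} {G : Subgroup (GL (Fin N) ℝ)} {ι κ : Type*}
  (B : Background M γ G ι κ)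

/-! ### Killing spinors in a chart -/

lemma isOrthonormalFrame {V : Set M} (hV : IsOpen V) (i : ι) :
    IsOrthonormalFrame B.metric (B.spin.e i) (V ∩ B.spin.U i) where
  isOpen := hV.inter (B.spin.isOpen i)
  smooth A := (B.spin.e_smooth i A).mono Set.inter_subset_right
  orthonormal x hx := B.spin.orthonormal i x hx.2

/-- The connection matrix of the gravitino operator in the direction `e_C`. -/
def gravitinoMatrix (T : Theory) (i : ι) (x : M) (C : Fin 10) : Mat32 :=
  match T with
  | .typeI => γ.spinRep (leviCivita B.metric (B.spin.e i) x C) +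
      (1 / 8 : ℝ) • ∑ A₁, ∑ A₂, B.Hcomp i x C A₁ A₂ • γ.up ![A₁, A₂]
  | .heterotic s => γ.spinRep fun A₁ A₂ => leviCivita B.metric (B.spin.e i) x C A₁ A₂ +
      ((s : ℤ) : ℝ) * (1 / 2) * B.Hcomp i x C A₁ A₂

lemma gravitino_eq (T : Theory) (i : ι) (ψ : M → Fin 32 → ℝ) (x : M) (C : Fin 10) :
    B.gravitino T i ψ x C = (fun a => dirDeriv (fun y => ψ y a) x (B.spin.e i C x)) +
      B.gravitinoMatrix T i x C *ᵥ ψ x := by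
  cases T with
  | typeI => simp only [gravitino, gravitinoMatrix, Matrix.add_mulVec, ← add_assoc]; rfl
  | heterotic s => rfl

lemma smoothFunOn_Hcomp (i : ι) (A₁ A₂ A₃ : Fin 10) :
    SmoothFunOn (fun x => B.Hcomp i x A₁ A₂ A₃) (B.spin.U i) := by
  have h := B.H.smooth (B.spin.U i) ![B.spin.e i A₁, B.spin.e i A₂, B.spin.e i A₃]
    (B.spin.isOpen i) (fun j => by fin_cases j <;> exact B.spin.e_smooth i _)
  have e : (fun x => B.H.form x fun j => (![B.spin.e i A₁, B.spin.e i A₂, B.spin.e i A₃] :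
      Fin 3 → VField M) j x) = fun x => B.Hcomp i x A₁ A₂ A₃ := by
    funext x
    refine congrArg (B.H.form x) ?_
    funext j
    fin_cases j <;> rfl
  rwa [e] at h

variable {B}

lemma continuousOn_gravitinoMatrix (T : Theory) {V : Set M} (hV : IsOpen V) (i : ι) (x₀ : M)
    (C : Fin 10) (a b : Fin 32) :
    ContinuousOn (fun y => B.gravitinoMatrix T i (chartInv x₀ y) C a b)
      (chartDomain x₀ (V ∩ B.spin.U i)) := by
  have hfr := B.isOrthonormalFrame hV i
  obtain ⟨θ, hθs, hθ⟩ := hfr.exists_dual_coframe x₀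
  have h1 : ∀ A₁ A₂, ContinuousOn
      (fun y => leviCivita B.metric (B.spin.e i) (chartInv x₀ y) C A₁ A₂)
      (chartDomain x₀ (V ∩ B.spin.U i)) := fun A₁ A₂ =>
    (continuousOn_frameConnection (isOpen_chartDomain hfr.isOpen) (hfr.contDiffOn_chartField x₀)
      hθs C A₁ A₂).congr fun y hy => hfr.leviCivita_chartInv hθ hy C A₁ A₂
  have h2 : ∀ A₁ A₂, ContinuousOn (fun y => B.Hcomp i (chartInv x₀ y) C A₁ A₂)
      (chartDomain x₀ (V ∩ B.spin.U i)) := fun A₁ A₂ =>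
    (contDiffOn_comp_chartInv ((B.smoothFunOn_Hcomp i C A₁ A₂).mono
      Set.inter_subset_right)).continuousOn
  have h3 : ∀ f : Fin 10 → Fin 10 → R10 → ℝ,
      (∀ A₁ A₂, ContinuousOn (f A₁ A₂) (chartDomain x₀ (V ∩ B.spin.U i))) → ∀ r : ℝ,
      ContinuousOn (fun y => (r • ∑ A₁, ∑ A₂, f A₁ A₂ y • γ.up ![A₁, A₂]) a b)
        (chartDomain x₀ (V ∩ B.spin.U i)) := by
    intro f hf r
    simp only [Matrix.smul_apply, Matrix.sum_apply, smul_eq_mul]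
    exact continuousOn_const.mul (continuousOn_finsetSum _ fun A₁ _ =>
      continuousOn_finsetSum _ fun A₂ _ => (hf A₁ A₂).mul continuousOn_const)
  cases T with
  | typeI => exact (h3 _ h1 _).add (h3 _ h2 _)
  | heterotic s => exact h3 _ (fun A₁ A₂ => (h1 A₁ A₂).add (continuousOn_const.mul (h2 A₁ A₂))) _

namespace IsKillingSpinor

variable {T : Theory} {V : Set M} {ψ : ι → M → Fin 32 → ℝ}

lemma contDiffOn_chart (h : B.IsKillingSpinor T V ψ) (i : ι) (x₀ : M) :
    ContDiffOn ℝ ∞ (fun y => ψ i (chartInv x₀ y)) (chartDomain x₀ (V ∩ B.spin.U i)) :=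
  contDiffOn_pi.2 fun a => contDiffOn_comp_chartInv (h.smooth i a)

lemma fderiv_chart (h : B.IsKillingSpinor T V ψ) (hV : IsOpen V) (i : ι) {x₀ : M} {y : R10}
    (hy : y ∈ chartDomain x₀ (V ∩ B.spin.U i)) (C : Fin 10) :
    fderiv ℝ (fun y => ψ i (chartInv x₀ y)) y (chartField x₀ (B.spin.e i C) y) =
      -(B.gravitinoMatrix T i (chartInv x₀ y) C *ᵥ ψ i (chartInv x₀ y)) := by
  have hO := hV.inter (B.spin.isOpen i)
  have h1 := h.gravitino i _ hy.2 C
  rw [gravitino_eq] at h1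
  rw [← eq_neg_of_add_eq_zero_left h1]
  have hd : DifferentiableAt ℝ (fun y => ψ i (chartInv x₀ y)) y :=
    ((h.contDiffOn_chart i x₀).differentiableOn (by simp)).differentiableAt
      ((isOpen_chartDomain hO).mem_nhds hy)
  ext a
  rw [← fderiv_comp_chartInv hO (h.smooth i a) (B.spin.e i C) hy,
    (hasFDerivAt_pi'.1 hd.hasFDerivAt a).fderiv]
  rfl

end IsKillingSpinor

variable {T : Theory} {V : Set M} {ψ : Fin 16 → ι → M → Fin 32 → ℝ}

/-! ### Unique continuation -/

/-- Constant combinations satisfy the same linear equation in the chart, so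
`eventually_eq_zero_of_frame` applies. -/
lemma eventually_sum_smul_eq_zero (hψ : ∀ n, B.IsKillingSpinor T V (ψ n)) (hV : IsOpen V) {i : ι}
    {x : M} (hx : x ∈ V ∩ B.spin.U i) {c : Fin 16 → ℝ} (h0 : ∑ n, c n • ψ n i x = 0) :
    ∀ᶠ x' in 𝓝 x, ∑ n, c n • ψ n i x' = 0 := by
  have hfr := B.isOrthonormalFrame hV i
  obtain ⟨θ, hθs, hθ⟩ := hfr.exists_dual_coframe x
  have hΩ := isOpen_chartDomain (x₀ := x) hfr.isOpen
  have hd : ∀ n, DifferentiableOn ℝ (fun y => ψ n i (chartInv x y))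
      (chartDomain x (V ∩ B.spin.U i)) := fun n =>
    ((hψ n).contDiffOn_chart i x).differentiableOn (by simp)
  have hinv : chartInv x (extChartAt (𝓡 10) x x) = x := extChartAt_to_inv x
  have hmem : extChartAt (𝓡 10) x x ∈ chartDomain x (V ∩ B.spin.U i) :=
    ⟨mem_extChartAt_target x, by rw [Set.mem_preimage, hinv]; exact hx⟩
  have key := eventually_eq_zero_of_frame hΩ hθ (fun A => (hθs A).continuousOn)
    (F := fun y => ∑ n, c n • ψ n i (chartInv x y))
    (B := fun C y => B.gravitinoMatrix T i (chartInv x y) C)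
    (DifferentiableOn.fun_sum fun n _ => (hd n).const_smul (c n))
    (fun C a b => continuousOn_gravitinoMatrix T hV i x C a b)
    (fun y hy C => by
      have hda : ∀ n, DifferentiableAt ℝ (fun y => ψ n i (chartInv x y)) y := fun n =>
        (hd n).differentiableAt (hΩ.mem_nhds hy)
      have hs : HasFDerivAt (fun y => ∑ n, c n • ψ n i (chartInv x y))
          (∑ n, c n • fderiv ℝ (fun y => ψ n i (chartInv x y)) y) y :=
        HasFDerivAt.fun_sum fun n _ => (hda n).hasFDerivAt.const_smul (c n)
      rw [hs.fderiv, sum_apply, Matrix.mulVec_sum, ← Finset.sum_neg_distrib]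
      refine Finset.sum_congr rfl fun n _ => ?_
      rw [smul_apply, (hψ n).fderiv_chart hV i hy, Matrix.mulVec_smul, smul_neg])
    hmem (by simpa only [hinv] using h0)
  have hcont : Tendsto (extChartAt (𝓡 10) x) (𝓝 x) (𝓝 (extChartAt (𝓡 10) x x)) :=
    continuousAt_extChartAt x
  filter_upwards [hcont.eventually key, extChartAt_source_mem_nhds (I := 𝓡 10) x] with z hz hz'
  have : chartInv x (extChartAt (𝓡 10) x z) = z := (extChartAt (𝓡 10) x).left_inv hz'
  simpa only [this] using hz

/-- Points where the combination vanishes in some trivialisation and points where it does not are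
both open and cover the connected set V. The cocycle makes vanishing independent of the
trivialisation, so they cannot meet. -/
lemma sum_smul_eq_zero (hψ : ∀ n, B.IsKillingSpinor T V (ψ n)) (hV : IsOpen V)
    (hVc : IsConnected V) {i : ι} {x : M} (hx : x ∈ V ∩ B.spin.U i) {c : Fin 16 → ℝ}
    (h0 : ∑ n, c n • ψ n i x = 0) (j : ι) {z : M} (hz : z ∈ V ∩ B.spin.U j) :
    ∑ n, c n • ψ n j z = 0 := by
  have hglue : ∀ k l, ∀ w ∈ V ∩ (B.spin.U k ∩ B.spin.U l), ∑ n, c n • ψ n l w = 0 →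
      ∑ n, c n • ψ n k w = 0 := by
    intro k l w hw hl
    have : ∑ n, c n • ψ n k w = B.spin.t k l w *ᵥ ∑ n, c n • ψ n l w := by
      rw [Matrix.mulVec_sum]
      exact Finset.sum_congr rfl fun n _ => by rw [(hψ n).glue k l w hw, Matrix.mulVec_smul]
    rw [this, hl, Matrix.mulVec_zero]
  let P : Set M := {w | ∃ k, w ∈ V ∩ B.spin.U k ∧ ∑ n, c n • ψ n k w = 0}
  let Q : Set M := {w | ∃ k, w ∈ V ∩ B.spin.U k ∧ ∑ n, c n • ψ n k w ≠ 0}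
  have hP : IsOpen P := by
    rw [isOpen_iff_eventually]
    rintro w ⟨k, hk, h⟩
    filter_upwards [(hV.inter (B.spin.isOpen k)).mem_nhds hk, eventually_sum_smul_eq_zero hψ hV hk h]
      with v hv hv' using ⟨k, hv, hv'⟩
  have hQ : IsOpen Q := by
    rw [isOpen_iff_eventually]
    rintro w ⟨k, hk, h⟩
    have hO := (hV.inter (B.spin.isOpen k)).mem_nhds hk
    have hc : ContinuousAt (fun v => ∑ n, c n • ψ n k v) w := by
      refine tendsto_finsetSum _ fun n _ => ?_
      refine Tendsto.const_smul (tendsto_pi_nhds.2 fun a => ?_) _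
      exact ((hψ n).smooth k a).continuousOn.continuousAt hO
    filter_upwards [hO, hc.eventually_ne h] with v hv hv' using ⟨k, hv, hv'⟩
  have hcover : V ⊆ P ∪ Q := by
    intro w hw
    obtain ⟨k, hk⟩ := B.spin.cover w
    by_cases h : ∑ n, c n • ψ n k w = 0
    · exact Or.inl ⟨k, ⟨hw, hk⟩, h⟩
    · exact Or.inr ⟨k, ⟨hw, hk⟩, h⟩
  by_contra hne
  obtain ⟨w, hw, ⟨k, hk, h⟩, ⟨l, hl, h'⟩⟩ := hVc.isPreconnected P Q hP hQ hcover
    ⟨x, hx.1, i, hx, h0⟩ ⟨z, hz.1, j, hz, hne⟩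
  exact h' (hglue l k w ⟨hw, hl.2, hk.2⟩ h)

lemma span_eq_plus (hψ : ∀ n, B.IsKillingSpinor T V (ψ n)) (hV : IsOpen V) (hVc : IsConnected V)
    (hli : ∀ c : Fin 16 → ℝ,
      (∀ i, ∀ x ∈ V ∩ B.spin.U i, ∑ n, c n • ψ n i x = 0) → ∀ n, c n = 0)
    {i : ι} {x : M} (hx : x ∈ V ∩ B.spin.U i) :
    Submodule.span ℝ (Set.range fun n => ψ n i x) = γ.plus := by
  have hind : LinearIndependent ℝ fun n => ψ n i x :=
    Fintype.linearIndependent_iff.2 fun c hc =>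
      hli c fun j z hz => sum_smul_eq_zero hψ hV hVc hx hc j hz
  refine Submodule.eq_of_le_of_finrank_le ?_ ?_
  · rw [Submodule.span_le]
    rintro _ ⟨n, rfl⟩
    exact (hψ n).chiral i x hx
  · rw [finrank_span_eq_card hind, Fintype.card_fin]
    exact γ.finrank_plus_le

lemma mulVec_eq_zero_of_span {v : Fin 16 → Fin 32 → ℝ}
    (hv : Submodule.span ℝ (Set.range v) = γ.plus) {X : Mat32} (hX : ∀ n, X *ᵥ v n = 0) :
    ∀ ε ∈ γ.plus, X *ᵥ ε = 0 := by
  have : γ.plus ≤ LinearMap.ker (Matrix.mulVecLin X) := by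
    rw [← hv, Submodule.span_le]
    rintro _ ⟨n, rfl⟩
    exact hX n
  exact fun ε hε => this hε

/-! ### Vanishing of the fluxes -/

lemma Hcomp_swap_left (i : ι) (x : M) (A₁ A₂ A₃ : Fin 10) :
    B.Hcomp i x A₂ A₁ A₃ = -B.Hcomp i x A₁ A₂ A₃ := by
  have h := (B.H.form x).map_swap ![B.spin.e i A₁ x, B.spin.e i A₂ x, B.spin.e i A₃ x]
    (i := 0) (j := 1) (by decide)
  refine Eq.trans (congrArg (B.H.form x) ?_) h
  funext j
  fin_cases j <;> rfl

lemma Hcomp_swap_right (i : ι) (x : M) (A₁ A₂ A₃ : Fin 10) :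
    B.Hcomp i x A₁ A₃ A₂ = -B.Hcomp i x A₁ A₂ A₃ := by
  have h := (B.H.form x).map_swap ![B.spin.e i A₁ x, B.spin.e i A₂ x, B.spin.e i A₃ x]
    (i := 1) (j := 2) (by decide)
  refine Eq.trans (congrArg (B.H.form x) ?_) h
  funext j
  fin_cases j <;> rfl

lemma curv_swap (k : κ) (X Y : VField M) (x : M) :
    B.gauge.curv k Y X x = -B.gauge.curv k X Y x := by
  rw [GaugeField.curv, GaugeField.curv, mlieBracket_swap_apply, map_neg]
  abel

lemma dilaton_three_form_eq_zero (hψ : ∀ n, B.IsKillingSpinor T V (ψ n)) {i : ι} {x : M}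
    (hx : x ∈ V ∩ B.spin.U i) (hsp : Submodule.span ℝ (Set.range fun n => ψ n i x) = γ.plus) :
    (∀ A, dirDeriv B.φ x (B.spin.e i A x) = 0) ∧ ∀ A₁ A₂ A₃, B.Hcomp i x A₁ A₂ A₃ = 0 := by
  have h := mulVec_eq_zero_of_span hsp fun n => (hψ n).dilatino i x hx
  have key : (fun A => dirDeriv B.φ x (B.spin.e i A x)) = 0 ∧ B.Hcomp i x = 0 := by
    cases T with
    | typeI =>
      exact γ.eq_zero_of_one_form_add_three_form_eq_zero (c := 1 / 12) (by norm_num)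
        (Hcomp_swap_left i x) (Hcomp_swap_right i x) h
    | heterotic s =>
      exact γ.eq_zero_of_one_form_add_three_form_eq_zero (c := -(1 / 12)) (by norm_num)
        (Hcomp_swap_left i x) (Hcomp_swap_right i x) h
  exact ⟨fun A => congrFun key.1 A, fun A₁ A₂ A₃ => congrFun (congrFun (congrFun key.2 A₁) A₂) A₃⟩

lemma curv_eq_zero (hψ : ∀ n, B.IsKillingSpinor T V (ψ n)) {i : ι} {k : κ} {x : M}
    (hx : x ∈ V ∩ B.spin.U i ∩ B.gauge.W k)
    (hsp : Submodule.span ℝ (Set.range fun n => ψ n i x) = γ.plus) (A₁ A₂ : Fin 10) :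
    B.gauge.curv k (B.spin.e i A₁) (B.spin.e i A₂) x = 0 := by
  ext p q
  refine γ.eq_zero_of_two_form_eq_zero
    (F := fun A₁ A₂ => B.gauge.curv k (B.spin.e i A₁) (B.spin.e i A₂) x p q)
    (fun A B' => by rw [curv_swap]; rfl)
    (mulVec_eq_zero_of_span hsp fun n => (hψ n).gaugino i k x hx p q) A₁ A₂

lemma gravitinoMatrix_of_Hcomp_eq_zero (T : Theory) {i : ι} {x : M}
    (h : ∀ A₁ A₂ A₃, B.Hcomp i x A₁ A₂ A₃ = 0) (C : Fin 10) :
    B.gravitinoMatrix T i x C = γ.spinRep (leviCivita B.metric (B.spin.e i) x C) := by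
  cases T with
  | typeI => simp [gravitinoMatrix, h]
  | heterotic s => simp [gravitinoMatrix, h]

/-- The smooth orthonormal frame as a basis of a tangent space. -/
lemma exists_basis_frame {i : ι} {x : M} (hx : x ∈ B.spin.U i) :
    ∃ b : Module.Basis (Fin 10) ℝ (TangentSpace (𝓡 10) x), ∀ A, b A = B.spin.e i A x := by
  have hli := (B.isOrthonormalFrame isOpen_univ i).linearIndependent (x := x) ⟨trivial, hx⟩
  have hcard : Fintype.card (Fin 10) = Module.finrank ℝ (TangentSpace (𝓡 10) x) := by
    change _ = Module.finrank ℝ R10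
    simp
  exact ⟨basisOfLinearIndependentOfCardEqFinrank hli hcard, fun A => by simp⟩

end Background

end Supersymmetry

/-! ### Parallel vectors from spinor bilinears -/

/-- If the bilinears of the spanning spinors missed a direction, a nonzero functional would
annihilate all of them, hence by bilinearity all pairs in `plus`, against the nondegeneracy `hK`.
This allows arbitrary initial values for parallel covectors. -/
lemma GammaMatrices.exists_coeff_of_span (γ : GammaMatrices) {K : Mat32}
    (hK : ∀ v : Fin 10 → ℝ, (∀ ε₁ ∈ γ.plus, ∀ ε₂ ∈ γ.plus,
      ∑ A, v A * (ε₁ ⬝ᵥ (K * γ.Γ A) *ᵥ ε₂) = 0) → v = 0) {v : Fin 16 → Fin 32 → ℝ}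
    (hv : Submodule.span ℝ (Set.range v) = γ.plus) (w : Fin 10 → ℝ) :
    ∃ c : Fin 16 × Fin 16 → ℝ, ∀ D, ∑ p, c p * (v p.1 ⬝ᵥ (K * γ.Γ D) *ᵥ v p.2) = w D := by
  let W : Fin 16 × Fin 16 → Fin 10 → ℝ := fun p D => v p.1 ⬝ᵥ (K * γ.Γ D) *ᵥ v p.2
  suffices h : Submodule.span ℝ (Set.range W) = ⊤ by
    have : w ∈ Submodule.span ℝ (Set.range W) := h ▸ Submodule.mem_top
    obtain ⟨c, hc⟩ := (Submodule.mem_span_range_iff_exists_fun ℝ).1 this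
    refine ⟨c, fun D => ?_⟩
    have := congrFun hc D
    simpa [W] using this
  by_contra hne
  obtain ⟨f, hf0, hf⟩ := Submodule.exists_le_ker_of_lt_top _ (lt_top_iff_ne_top.2 hne)
  let n : Fin 10 → ℝ := fun A => f (Pi.single A 1)
  have hfn : ∀ u, f u = ∑ A, n A * u A := by
    intro u
    rw [LinearMap.pi_apply_eq_sum_univ f u]
    refine Finset.sum_congr rfl fun A _ => ?_
    rw [smul_eq_mul, mul_comm]
    congr 2
    ext j
    simp [Pi.single_apply, eq_comm]
  have hker : ∀ p, ∑ A, n A * W p A = 0 := fun p => by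
    rw [← hfn]; exact hf (Submodule.subset_span ⟨p, rfl⟩)
  have hn : n = 0 := by
    refine hK n fun ε₁ h₁ ε₂ h₂ => ?_
    rw [← hv] at h₁ h₂
    induction h₁ using Submodule.span_induction with
    | mem x hx =>
      obtain ⟨k, rfl⟩ := hx
      induction h₂ using Submodule.span_induction with
      | mem x hx => obtain ⟨l, rfl⟩ := hx; exact hker (k, l)
      | zero => simp
      | add x y _ _ hx hy =>
        simp only [Matrix.mulVec_add, dotProduct_add, mul_add, Finset.sum_add_distrib, hx, hy,
          add_zero]
      | smul r x _ hx =>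
        simp only [Matrix.mulVec_smul, dotProduct_smul, smul_eq_mul, mul_left_comm _ r,
          ← Finset.mul_sum, hx, mul_zero]
    | zero => simp
    | add x y _ _ hx hy =>
      simp only [add_dotProduct, mul_add, Finset.sum_add_distrib, hx, hy, add_zero]
    | smul r x _ hx =>
      simp only [smul_dotProduct, smul_eq_mul, mul_left_comm _ r, ← Finset.mul_sum, hx, mul_zero]
  exact hf0 (LinearMap.ext fun u => by rw [hfn, hn]; simp)

section

variable {M : Type*} [TopologicalSpace M] [ChartedSpace R10 M] [IsManifold (𝓡 10) ∞ M]

/-- Flat coordinates in a chart give a local isometry to Minkowski space. -/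
lemma exists_isometry_of_flat_coordinates (g : LorentzMetric M) {x : M} {Ω : Set R10}
    (hΩ : IsOpen Ω) (hΩt : Ω ⊆ (extChartAt (𝓡 10) x).target) (hx : extChartAt (𝓡 10) x x ∈ Ω)
    {f : R10 → R10} (hf : ContDiffOn ℝ ∞ f Ω)
    (hinj : ∀ y ∈ Ω, Function.Injective (fderiv ℝ f y))
    (hiso : ∀ y ∈ Ω, ∀ u v, minkowski (fderiv ℝ f y u) (fderiv ℝ f y v) =
      g.g (chartInv x y) (mfderiv 𝓘(ℝ, R10) (𝓡 10) (chartInv x) y u)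
        (mfderiv 𝓘(ℝ, R10) (𝓡 10) (chartInv x) y v)) :
    ∃ Φ : PartialDiffeomorph (𝓡 10) (𝓡 10) M R10 ∞, x ∈ Φ.source ∧
      ∀ y ∈ Φ.source, ∀ u v : TangentSpace (𝓡 10) y,
        minkowski (mfderiv (𝓡 10) (𝓡 10) Φ y u) (mfderiv (𝓡 10) (𝓡 10) Φ y v) = g.g y u v := by
  have hfat : ∀ y ∈ Ω, ContDiffAt ℝ ∞ f y := fun y hy => hf.contDiffAt (hΩ.mem_nhds hy)
  have hequiv : ∀ y ∈ Ω, ∃ L : R10 ≃L[ℝ] R10, HasFDerivAt f (L : R10 →L[ℝ] R10) y := by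
    intro y hy
    refine ⟨(LinearEquiv.ofInjectiveEndo (fderiv ℝ f y : R10 →ₗ[ℝ] R10)
      (hinj y hy)).toContinuousLinearEquiv, ?_⟩
    refine ((hfat y hy).differentiableAt (by simp)).hasFDerivAt.congr_fderiv ?_
    ext v : 1
    rfl
  obtain ⟨L, hL⟩ := hequiv _ hx
  let h₀ := (hfat _ hx).toOpenPartialHomeomorph f hL (by simp)
  have hx₀ : extChartAt (𝓡 10) x x ∈ h₀.source :=
    (hfat _ hx).mem_toOpenPartialHomeomorph_source hL (by simp)
  -- On Ω the derivative of f is invertible at every point, so after this restriction the local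
  -- inverse is smooth on its whole domain and not merely at the image of x.
  let h := h₀.restrOpen Ω hΩ
  have hsymm : ContDiffOn ℝ ∞ h.symm h.target := by
    intro z hz
    have hz' : h.symm z ∈ Ω := (h.map_target hz).2
    obtain ⟨L', hL'⟩ := hequiv _ hz'
    exact (h.contDiffAt_symm hz hL' (hfat _ hz')).contDiffWithinAt
  let Φ : PartialDiffeomorph (𝓡 10) (𝓡 10) M R10 ∞ :=
    { toPartialEquiv := (extChartAt (𝓡 10) x).trans h.toPartialEquiv
      open_source := (continuousOn_extChartAt x).isOpen_inter_preimage
        (isOpen_extChartAt_source x) h.open_source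
      open_target := h.symm.continuousOn.isOpen_inter_preimage h.open_target
        (isOpen_extChartAt_target x)
      contMDiffOn_toFun := by
        have h1 : ContMDiffOn (𝓡 10) (𝓡 10) ∞ (extChartAt (𝓡 10) x)
            ((extChartAt (𝓡 10) x).source ∩ extChartAt (𝓡 10) x ⁻¹' h.source) := by
          rw [extChartAt_source]
          exact contMDiffOn_extChartAt.mono Set.inter_subset_left
        exact hf.contMDiffOn.comp h1 fun z hz => hz.2.2
      contMDiffOn_invFun := by
        have h1 : ContMDiffOn (𝓡 10) (𝓡 10) ∞ h.symm
            (h.target ∩ h.symm ⁻¹' (extChartAt (𝓡 10) x).target) :=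
          hsymm.contMDiffOn.mono Set.inter_subset_left
        exact (contMDiffOn_extChartAt_symm x).comp h1 fun z hz => hz.2 }
  refine ⟨Φ, ⟨mem_extChartAt_source x, hx₀, hx⟩, fun z hz => ?_⟩
  obtain ⟨y, hyΩ, rfl⟩ : ∃ y ∈ Ω, chartInv x y = z :=
    ⟨extChartAt (𝓡 10) x z, hz.2.2, (extChartAt (𝓡 10) x).left_inv hz.1⟩
  have hyd : y ∈ chartDomain x Set.univ := ⟨hΩt hyΩ, trivial⟩
  have h1 : MDifferentiableAt (𝓡 10) (𝓡 10) Φ (chartInv x y) :=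
    (Φ.contMDiffOn_toFun.contMDiffAt (Φ.open_source.mem_nhds hz)).mdifferentiableAt (by simp)
  have h2 := (contMDiffAt_chartInv hyd).mdifferentiableAt (by simp)
  have h3 := mfderiv_comp y h1 h2
  have h4 : (Φ ∘ chartInv x) =ᶠ[𝓝 y] f := by
    filter_upwards [hΩ.mem_nhds hyΩ] with w hw
    exact congrArg f ((extChartAt (𝓡 10) x).right_inv (hΩt hw))
  rw [h4.mfderiv_eq, mfderiv_eq_fderiv] at h3
  have h5 : ∀ w : R10, mfderiv (𝓡 10) (𝓡 10) Φ (chartInv x y)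
      (mfderiv 𝓘(ℝ, R10) (𝓡 10) (chartInv x) y w) = fderiv ℝ f y w := fun w =>
    (congrArg (fun L : R10 →L[ℝ] R10 => L w) h3).symm
  intro u v
  have hs := (isInvertible_mfderiv_chartInv hyd).self_apply_inverse
  rw [← hs u, ← hs v]
  exact (congrArg₂ minkowski (h5 _) (h5 _)).trans (hiso y hyΩ _ _)

lemma eventually_eq_of_mfderiv_eq_zero {φ : M → ℝ} (hφ : SmoothFunOn φ Set.univ)
    (h : ∀ x, mfderiv (𝓡 10) 𝓘(ℝ, ℝ) φ x = 0) (x : M) : ∀ᶠ x' in 𝓝 x, φ x' = φ x := by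
  have hd : DifferentiableOn ℝ (fun y => φ (chartInv x y)) (chartDomain x Set.univ) :=
    (contDiffOn_comp_chartInv hφ).differentiableOn (by simp)
  have hmem : extChartAt (𝓡 10) x x ∈ chartDomain x Set.univ := ⟨mem_extChartAt_target x, trivial⟩
  obtain ⟨r, hr, hball⟩ := Metric.isOpen_iff.1 (isOpen_chartDomain isOpen_univ) _ hmem
  have hconst : ∀ y ∈ Metric.ball (extChartAt (𝓡 10) x x) r, φ (chartInv x y) = φ x := by
    intro y hy
    have := Metric.isOpen_ball.is_const_of_fderiv_eq_zero (𝕜 := ℝ)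
      (convex_ball (extChartAt (𝓡 10) x x) r).isPreconnected (hd.mono hball)
      (fun z hz => ?_) hy (Metric.mem_ball_self hr)
    · rw [this]
      exact congrArg φ (extChartAt_to_inv x)
    · have h1 : MDifferentiableAt (𝓡 10) 𝓘(ℝ, ℝ) φ (chartInv x z) :=
        (hφ.contMDiffAt Filter.univ_mem).mdifferentiableAt (by simp)
      have h2 := (contMDiffAt_chartInv (hball hz)).mdifferentiableAt (by simp)
      have h3 := mfderiv_comp z h1 h2
      rw [mfderiv_eq_fderiv, h] at h3
      exact h3.trans (ContinuousLinearMap.zero_comp _)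
  filter_upwards [(continuousAt_extChartAt (I := 𝓡 10) x).eventually
    (Metric.isOpen_ball.mem_nhds (Metric.mem_ball_self hr)),
    extChartAt_source_mem_nhds (I := 𝓡 10) x] with z hz hz'
  rw [← hconst _ hz]
  exact congrArg φ ((extChartAt (𝓡 10) x).left_inv hz').symm

namespace Background

variable {γ : GammaMatrices} {N : ℕ} {G : Subgroup (GL (Fin N) ℝ)} {ι κ : Type*}
  {B : Background M γ G ι κ} {T : Theory} {V : Set M} {ψ : Fin 16 → ι → M → Fin 32 → ℝ}

lemma exists_isometry (hψ : ∀ n, B.IsKillingSpinor T V (ψ n)) (hV : IsOpen V) {i : ι}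
    {x : M} (hx : x ∈ V ∩ B.spin.U i)
    (hH : ∀ z ∈ V ∩ B.spin.U i, ∀ A₁ A₂ A₃, B.Hcomp i z A₁ A₂ A₃ = 0)
    (hsp : Submodule.span ℝ (Set.range fun n => ψ n i x) = γ.plus) :
    ∃ Φ : PartialDiffeomorph (𝓡 10) (𝓡 10) M R10 ∞, x ∈ Φ.source ∧
      ∀ y ∈ Φ.source, ∀ u v : TangentSpace (𝓡 10) y,
        minkowski (mfderiv (𝓡 10) (𝓡 10) Φ y u) (mfderiv (𝓡 10) (𝓡 10) Φ y v) =
          B.metric.g y u v := by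
  have hfr := B.isOrthonormalFrame hV i
  obtain ⟨θ, hθs, hθ⟩ := hfr.exists_dual_coframe x
  obtain ⟨K, hK, hK'⟩ := γ.exists_spinor_form
  have hinv : chartInv x (extChartAt (𝓡 10) x x) = x := extChartAt_to_inv x
  have hmem : extChartAt (𝓡 10) x x ∈ chartDomain x (V ∩ B.spin.U i) :=
    ⟨mem_extChartAt_target x, by rw [Set.mem_preimage, hinv]; exact hx⟩
  obtain ⟨r, hr, hball⟩ := Metric.isOpen_iff.1 (isOpen_chartDomain hfr.isOpen) _ hmem
  have hopen : IsOpen (Metric.ball (extChartAt (𝓡 10) x x) r) := Metric.isOpen_ball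
  -- Constants for which the a-th combination of bilinears has components δ_aD at x; being constant,
  -- they keep the combination parallel.
  choose c hc using fun a : Fin 10 =>
    γ.exists_coeff_of_span hK' hsp (fun D => if a = D then 1 else 0)
  let F : Fin 16 → R10 → Fin 32 → ℝ := fun n y => ψ n i (chartInv x y)
  have hF : ∀ n, ContDiffOn ℝ ∞ (F n) (Metric.ball (extChartAt (𝓡 10) x x) r) := fun n =>
    ((hψ n).contDiffOn_chart i x).mono hball
  have hFd : ∀ y ∈ Metric.ball (extChartAt (𝓡 10) x x) r, ∀ n C,
      fderiv ℝ (F n) y (chartField x (B.spin.e i C) y) =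
        -(γ.spinRep (frameConnection (fun A => chartField x (B.spin.e i A)) θ y C) *ᵥ F n y) := by
    intro y hy n C
    have h1 : leviCivita B.metric (B.spin.e i) (chartInv x y) C =
        frameConnection (fun A => chartField x (B.spin.e i A)) θ y C := by
      ext A₁ A₂
      exact hfr.leviCivita_chartInv hθ (hball hy) C A₁ A₂
    rw [(hψ n).fderiv_chart hV i (hball hy),
      gravitinoMatrix_of_Hcomp_eq_zero T (hH _ (hball hy).2), h1]
  let b : Fin 16 × Fin 16 → Fin 10 → R10 → ℝ := fun p D y =>
    F p.1 y ⬝ᵥ (K * γ.Γ D) *ᵥ F p.2 y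
  -- The spinor bilinear as a continuous bilinear map, which makes it smooth and gives the product
  -- rule.
  let Q : Fin 10 → (Fin 32 → ℝ) →L[ℝ] (Fin 32 → ℝ) →L[ℝ] ℝ := fun D =>
    (Matrix.toLinearMap₂' ℝ (K * γ.Γ D)).toContinuousBilinearMap
  have hQ : ∀ D ε₁ ε₂, Q D ε₁ ε₂ = ε₁ ⬝ᵥ (K * γ.Γ D) *ᵥ ε₂ := by
    intro D ε₁ ε₂
    simp [Q, Matrix.toLinearMap₂'_apply']
  have hbs : ∀ p D, ContDiffOn ℝ ∞ (b p D) (Metric.ball (extChartAt (𝓡 10) x x) r) := by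
    intro p D
    have : ContDiffOn ℝ ∞ (fun y => Q D (F p.1 y) (F p.2 y))
        (Metric.ball (extChartAt (𝓡 10) x x) r) :=
      ((Q D).contDiff.comp_contDiffOn (hF p.1)).clm_apply (hF p.2)
    exact this.congr fun y _ => (hQ D _ _).symm
  have hbd : ∀ y ∈ Metric.ball (extChartAt (𝓡 10) x x) r, ∀ p C D,
      fderiv ℝ (b p D) y (chartField x (B.spin.e i C) y) =
        -∑ E, frameConnection (fun A => chartField x (B.spin.e i A)) θ y C D E * eta E *
          b p E y := by
    intro y hy p C D
    have hd : ∀ n, DifferentiableAt ℝ (F n) y := fun n =>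
      ((hF n).differentiableOn (by simp)).differentiableAt (hopen.mem_nhds hy)
    have h1 : b p D = fun y => Q D (F p.1 y) (F p.2 y) := funext fun y => (hQ D _ _).symm
    have h2 := (Q D).hasFDerivAt_of_bilinear (hd p.1).hasFDerivAt (hd p.2).hasFDerivAt
    rw [h1, h2.fderiv]
    refine Eq.trans ?_ (γ.bilinear_spinRep hK
      (om := frameConnection (fun A => chartField x (B.spin.e i A)) θ y C)
      (fun A B' => frameConnection_antisymm y C A B') (F p.1 y) (F p.2 y) D)
    rw [← hFd y hy, ← hFd y hy, ← hQ, ← hQ, add_comm]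
    rfl
  obtain ⟨f, hf, hiso⟩ := exists_flat_coordinates (W := fun a D y => ∑ p, c a p * b p D y)
    hopen (convex_ball _ r) (fun A => (hfr.contDiffOn_chartField x A).mono hball)
    (fun A => (hθs A).mono hball)
    ⟨fun y hy => hθ.apply_frame y (hball hy), fun y hy => hθ.sum_smul y (hball hy)⟩
    (fun a D => ContDiffOn.sum fun p _ => contDiffOn_const.mul (hbs p D))
    (fun y hy a C D => by
      have hd : HasFDerivAt (fun y => ∑ p, c a p * b p D y)
          (∑ p, c a p • fderiv ℝ (b p D) y) y := HasFDerivAt.fun_sum fun p _ =>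
        (((hbs p D).differentiableOn (by simp)).differentiableAt
          (hopen.mem_nhds hy)).hasFDerivAt.const_mul (c a p)
      rw [hd.fderiv]
      simp only [sum_apply, smul_apply, hbd y hy, smul_eq_mul, mul_neg, Finset.sum_neg_distrib,
        Finset.mul_sum]
      rw [Finset.sum_comm]
      congr 1
      exact Finset.sum_congr rfl fun E _ => Finset.sum_congr rfl fun p _ => by ring)
    (Metric.mem_ball_self hr)
    (fun a D => by simpa only [b, F, hinv] using hc a D)
  refine exists_isometry_of_flat_coordinates B.metric hopen (fun y hy => (hball hy).1)
    (Metric.mem_ball_self hr) hf (fun y hy => ?_) (fun y hy u v => ?_)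
  -- A vector killed by df is orthogonal to every frame vector by the isometry identity, so all its
  -- frame components vanish.
  · rw [injective_iff_map_eq_zero]
    intro u hu
    have h1 : ∀ A, θ A y u = 0 := by
      intro A
      have h2 := hiso y hy u (chartField x (B.spin.e i A) y)
      rw [hu] at h2
      simp only [hθ.apply_frame y (hball hy), mul_ite, mul_one, mul_zero, Finset.sum_ite_eq',
        Finset.mem_univ, if_true] at h2
      have h3 : eta A * θ A y u = 0 := h2.symm.trans (by simp [minkowski])
      exact (mul_eq_zero.1 h3).resolve_left (eta_ne_zero A)
    rw [← hθ.sum_smul y (hball hy) u]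
    simp [h1]
  · rw [hiso y hy, hfr.metric_chartInv hθ (hball hy)]

end Background

end

end Sugra

end

/-! ### The theorem, assembled from the local results -/

open Sugra in
theorem theorem4 {M : Type*} [TopologicalSpace M] [ChartedSpace R10 M] [IsManifold (𝓡 10) ∞ M]
    [ConnectedSpace M] (γ : GammaMatrices) {N : ℕ} (G : Subgroup (GL (Fin N) ℝ))
    (hG : IsClosed (G : Set (GL (Fin N) ℝ))) {ι κ : Type*} (T : Theory)
    (B : Background M γ G ι κ) (hB : B.MaximallySupersymmetric T) :
    LocallyMinkowski B.metric ∧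
    (∃ c : ℝ, ∀ x, B.φ x = c) ∧
    (∀ x, B.H.form x = 0) ∧
    (∀ i k, ∀ x ∈ B.spin.U i ∩ B.gauge.W k, ∀ A₁ A₂,
      B.gauge.curv k (B.spin.e i A₁) (B.spin.e i A₂) x = 0) := by
  have key : ∀ x, ∃ (V : Set M) (ψ : Fin 16 → ι → M → Fin 32 → ℝ), IsOpen V ∧ x ∈ V ∧
      (∀ n, B.IsKillingSpinor T V (ψ n)) ∧ ∀ i, ∀ z ∈ V ∩ B.spin.U i,
        Submodule.span ℝ (Set.range fun n => ψ n i z) = γ.plus := by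
    intro x
    obtain ⟨V, hV, hVc, hxV, ψ, hψ, hli⟩ := hB x
    exact ⟨V, ψ, hV, hxV, hψ, fun i z hz => Background.span_eq_plus hψ hV hVc hli hz⟩
  refine ⟨fun x => ?_, ?_, fun x => ?_, fun i k x hx A₁ A₂ => ?_⟩
  · obtain ⟨V, ψ, hV, hxV, hψ, hsp⟩ := key x
    obtain ⟨i, hi⟩ := B.spin.cover x
    exact Background.exists_isometry hψ hV ⟨hxV, hi⟩
      (fun z hz => (Background.dilaton_three_form_eq_zero hψ hz (hsp i z hz)).2)
      (hsp i x ⟨hxV, hi⟩)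
  · have hd : ∀ x, mfderiv (𝓡 10) 𝓘(ℝ, ℝ) B.φ x = 0 := by
      intro x
      obtain ⟨V, ψ, hV, hxV, hψ, hsp⟩ := key x
      obtain ⟨i, hi⟩ := B.spin.cover x
      obtain ⟨b, hb⟩ := Background.exists_basis_frame (B := B) hi
      have h1 := (Background.dilaton_three_form_eq_zero hψ ⟨hxV, hi⟩ (hsp i x ⟨hxV, hi⟩)).1
      refine ContinuousLinearMap.coe_injective (b.ext fun A => ?_)
      rw [hb]
      exact h1 A
    -- Vanishing of dφ gives only local constancy; connectedness of M makes the constant global.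
    have hloc : IsLocallyConstant B.φ :=
      (IsLocallyConstant.iff_eventually_eq _).2 (eventually_eq_of_mfderiv_eq_zero B.φ_smooth hd)
    obtain ⟨x₀⟩ : Nonempty M := inferInstance
    exact ⟨B.φ x₀, fun x => hloc.apply_eq_of_preconnectedSpace x x₀⟩
  · obtain ⟨V, ψ, hV, hxV, hψ, hsp⟩ := key x
    obtain ⟨i, hi⟩ := B.spin.cover x
    obtain ⟨b, hb⟩ := Background.exists_basis_frame (B := B) hi
    have h1 := (Background.dilaton_three_form_eq_zero hψ ⟨hxV, hi⟩ (hsp i x ⟨hxV, hi⟩)).2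
    refine b.ext_alternating fun v _ => ?_
    refine Eq.trans (congrArg (B.H.form x) ?_) (h1 (v 0) (v 1) (v 2))
    funext j
    fin_cases j <;> exact hb _
  · obtain ⟨V, ψ, hV, hxV, hψ, hsp⟩ := key x
    exact Background.curv_eq_zero hψ ⟨⟨hxV, hx.1⟩, hx.2⟩ (hsp i x ⟨hxV, hx.1⟩) A₁ A₂
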